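/- Let $f,g:\mathbb R^d\to\mathbb R^d$ be $C^\infty$ and consider the Stratonovich equation $dy=f(y)\,dt+g(y)\circ dW(t)$, where $W$ is a real-valued process (for instance a standard Brownian motion; the statement is pathwise and uses no property of $W$). Suppose that $I(y)=y^TCy$, with $C$ a symmetric $d\times d$ matrix, is an invariant: $\nabla I(y)^Tf(y)=0=\nabla I(y)^Tg(y)$ for all $y$. Let $A,B\in\mathbb R^{s\times s}$, $\alpha,\beta\in\mathbb R^s$, and consider the $s$-stage stochastic Runge–Kutta method with step size $h>0$, $t_n=nh$, $\Delta W_n=W(t_{n+1})-W(t_n)$, $$Y_{n,i}=y_n+h\sum_{j=1}^s a_{ij}f(Y_{n,j})+\Delta W_n\sum_{j=1}^s b_{ij}g(Y_{n,j}),\qquad y_{n+1}=y_n+h\sum_{i=1}^s\alpha_if(Y_{n,i})+\Delta W_n\sum_{i=1}^s\beta_ig(Y_{n,i}),$$ for $n=0,\dots,N_T-1$. *Trees.* Let $\Gamma$ be the set of (isomorphism classes of) rooted trees whose nodes are coloured $0$ (deterministic) or $1$ (stochastic), $\Gamma_k$ the set of those with root of colour $k$, and $[\iota_1,\dots,\iota_\ell]_k$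 the tree obtained by joining $\iota_1,\dots,\iota_\ell$ to a new root of colour $k$. Let $\rho(\iota)$ be the number of nodes, $\alpha(\iota)$ the number of different monotonic labelings of $\iota$, $\gamma([\iota_1,\dots,\iota_\ell]_k)=\rho([\iota_1,\dots,\iota_\ell]_k)\prod_j\gamma(\iota_j)$ the density, and $\omega(\iota)=\alpha(\iota)\gamma(\iota)/\rho(\iota)!$. With $g_0=f$, $g_1=g$, the elementary differentials are $$F([\iota_1,\dots,\iota_\ell]_k)(y)=g_k^{(\ell)}(y)\bigl(F(\iota_1)(y),\dots,F(\iota_\ell)(y)\bigr).$$ With $Z_0=hA$, $Z_1=\Delta W_nB$ let $\Phi([\iota_1,\dots,\iota_\ell]_k)=\prod_j Z_{k_j}\Phi(\iota_j)\in\mathbb R^s$ (componentwise product, $k_j$ the root colour of $\iota_j$; the vector of ones for a single node). Put $\Omega(\iota,\iota')(y)=F(\iota)(y)^TC\,F(\iota')(y)$ and $$M^0=\mathrm{diag}(\alpha)A+A^T\mathrm{diag}(\alpha)-\alpha\alpha^T,\quad M^*=\mathrm{diag}(\alpha)B+A^T\mathrm{diag}(\beta)-\alpha\beta^T,\quad M^1=\mathrm{diag}(\beta)B+B^T\mathrm{diag}(\beta)-\beta\beta^T.$$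 *Claim.* $$\begin{aligned}I(y_{n+1})-I(y_n)=&-\sum_{\iota\in\Gamma_0,\,\iota'\in\Gamma_0}\omega(\iota)\omega(\iota')\,(h\Phi(\iota))^TM^0(h\Phi(\iota'))\,\Omega(\iota,\iota')(y_n)\\&-2\sum_{\iota\in\Gamma_0,\,\iota'\in\Gamma_1}\omega(\iota)\omega(\iota')\,(h\Phi(\iota))^TM^*(\Delta W_n\Phi(\iota'))\,\Omega(\iota,\iota')(y_n)\\&-\sum_{\iota\in\Gamma_1,\,\iota'\in\Gamma_1}\omega(\iota)\omega(\iota')\,(\Delta W_n\Phi(\iota))^TM^1(\Delta W_n\Phi(\iota'))\,\Omega(\iota,\iota')(y_n)\end{aligned}\tag{$*$}$$ in the following sense. For all $R\in\mathbb R$ and $r>0$ there are $\delta>0$ and constants $K_0,K_1,K_2,\dots$, depending only on $f,g,C,A,B,\alpha,\beta,R,r$, such that: 1. if $0<h\le\delta$, $|w|\le\delta$ and $\|y\|\le R$, the stage equations with $y_n=y$, $\Delta W_n=w$ have exactly one solution with $\|Y_i-y\|\le r$ for all $i$; 2. for every process $W$, every realisation, every $0<h\le\delta$, every solution $(y_n,Y_{n,i})$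 of the method and every $n<N_T$ with $|\Delta W_n|\le\delta$, $\|y_n\|\le R$ and $\|Y_{n,i}-y_n\|\le r$ for all $i$: (a) $(*)$ holds as an expansion to every order in $(h,\Delta W_n)$: for every $N\ge0$, if the three sums are restricted to the pairs with $\rho(\iota)+\rho(\iota')\le N$, the two sides of $(*)$ differ by at most $K_N(h+|\Delta W_n|)^{N+1}$; (b) if $f$ and $g$ are moreover real-analytic on $\mathbb R^d$, the three double series converge absolutely and $(*)$ is an equality of real numbers. -/

import Mathlib

open scoped Matrix ContDiff

namespace SRK

/-- The iterated derivatives of a smooth function are symmetric. -/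
theorem iteratedFDeriv_comp_perm {E F : Type*} [NormedAddCommGroup E] [NormedSpace ℝ E]
    [NormedAddCommGroup F] [NormedSpace ℝ F] {f : E → F} (hf : ContDiff ℝ ∞ f) (n : ℕ) :
    ∀ (σ : Equiv.Perm (Fin n)) (x : E) (v : Fin n → E),
      iteratedFDeriv ℝ n f x (v ∘ σ) = iteratedFDeriv ℝ n f x v := by
  have hsm : ∀ m : ℕ, ContDiff ℝ ∞ (iteratedFDeriv ℝ m f) := fun m =>
    hf.iteratedFDeriv_right (le_of_eq rfl)
  have hdiff : ∀ m : ℕ, Differentiable ℝ (iteratedFDeriv ℝ m f) := fun m =>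
    (hsm m).differentiable (by simp)
  induction n with
  | zero =>
    intro σ x v
    congr 1
    exact Subsingleton.elim _ _
  | succ n ih =>
    intro σ
    have hσ : σ ∈ Submonoid.closure
        (Set.range fun i : Fin n => Equiv.swap i.castSucc i.succ) := by
      rw [Equiv.Perm.mclosure_swap_castSucc_succ]; trivial
    induction hσ using Submonoid.closure_induction with
    | one => intro x v; rfl
    | mul a b _ _ ha hb =>
      intro x v
      have := hb x (v ∘ a)
      rw [ha] at this
      exact this
    | mem τ h =>
      obtain ⟨i, rfl⟩ := h
      intro x v
      rw [iteratedFDeriv_succ_apply_left, iteratedFDeriv_succ_apply_left]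
      cases n with
      | zero => exact i.elim0
      | succ n =>
        rcases Fin.eq_zero_or_eq_succ i with rfl | ⟨j, rfl⟩
        · have key : ∀ (a b : E) (w : Fin n → E),
              fderiv ℝ (iteratedFDeriv ℝ (n + 1) f) x a (Fin.cons b w) =
                fderiv ℝ (fderiv ℝ (iteratedFDeriv ℝ n f)) x a b w := by
            intro a b w
            rw [← fderiv_continuousMultilinear_apply_const_apply (hdiff (n + 1) x)]
            have h1 : (fun y => iteratedFDeriv ℝ (n + 1) f y (Fin.cons b w : Fin (n + 1) → E)) =
                fun y => fderiv ℝ (iteratedFDeriv ℝ n f) y b w := by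
              funext y
              rw [iteratedFDeriv_succ_apply_left]
              simp
            have hd : Differentiable ℝ (fderiv ℝ (iteratedFDeriv ℝ n f)) :=
              ((hsm n).fderiv_right (m := ∞) (by simp)).differentiable (by simp)
            rw [h1]
            rw [fderiv_continuousMultilinear_apply_const_apply
              ((hd x).clm_apply (differentiableAt_const b))]
            rw [fderiv_clm_apply (hd x) (differentiableAt_const b)]
            simp
          have hs := ((hsm n).contDiffAt (x := x)).isSymmSndFDerivAt (by
            simp only [minSmoothness_of_isRCLikeNormedField]
            exact WithTop.coe_le_coe.2 (le_top : (2 : ℕ∞) ≤ ⊤))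
          rw [← Fin.cons_self_tail (Fin.tail v), ← Fin.cons_self_tail (Fin.tail (v ∘ _)), key, key]
          have e1 : Fin.tail (Fin.tail (v ∘ (Equiv.swap (Fin.castSucc (0 : Fin (n+1)))
              (Fin.succ 0)))) = Fin.tail (Fin.tail v) := by
            funext k
            simp only [Fin.tail, Function.comp]
            rw [Equiv.swap_apply_of_ne_of_ne]
            · simp [Fin.ext_iff]
            · simp [Fin.ext_iff]
          rw [e1]
          have e2 : (v ∘ (Equiv.swap (Fin.castSucc (0 : Fin (n+1))) (Fin.succ 0))) 0 = v 1 := by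
            simp
          have e3 : Fin.tail (v ∘ (Equiv.swap (Fin.castSucc (0 : Fin (n+1))) (Fin.succ 0))) 0
              = v 0 := by
            simp [Fin.tail]
          rw [e2, e3, hs.eq]
          rfl
        · have e1 : Fin.tail (v ∘ (Equiv.swap j.succ.castSucc j.succ.succ)) =
              Fin.tail v ∘ (Equiv.swap j.castSucc j.succ) := by
            funext k
            simp only [Fin.tail, Function.comp, ← Fin.succ_castSucc]
            rw [(Fin.succ_injective _).map_swap]
          have e2 : (v ∘ (Equiv.swap j.succ.castSucc j.succ.succ)) 0 = v 0 := by
            simp only [Function.comp]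
            rw [Equiv.swap_apply_of_ne_of_ne] <;> simp [Fin.ext_iff]
          rw [e1, e2, ← fderiv_continuousMultilinear_apply_const_apply (hdiff (n + 1) x),
            ← fderiv_continuousMultilinear_apply_const_apply (hdiff (n + 1) x)]
          simp only [ih]

/-! ### Rooted trees with nodes coloured by `0` (deterministic) and `1` (stochastic) -/

/-- Ordered (plane) rooted trees with coloured nodes: `node k l c` has a root of colour `k`
to which the roots of the `l` subtrees `c 0, …, c (l - 1)` are attached. -/
inductive OTree : Type
  | node (k : Fin 2) (l : ℕ) (c : Fin l → OTree) : OTree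

namespace OTree

/-- Isomorphism of coloured rooted trees: same root colour, and the subtrees of the two roots
can be matched up by isomorphisms. -/
inductive Iso : OTree → OTree → Prop
  | node (k : Fin 2) (l : ℕ) (c c' : Fin l → OTree) (σ : Equiv.Perm (Fin l))
      (h : ∀ j, Iso (c j) (c' (σ j))) : Iso (.node k l c) (.node k l c')

theorem Iso.refl (t : OTree) : Iso t t := by
  induction t with
  | node k l c ih => exact .node k l c c 1 ih

theorem Iso.symm {t u : OTree} (h : Iso t u) : Iso u t := by
  induction h with
  | node k l c c' σ h ih =>
    refine .node k l c' c σ⁻¹ fun j => ?_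
    have := ih (σ⁻¹ j)
    simpa using this

theorem Iso.trans {t u v : OTree} (h : Iso t u) (h' : Iso u v) : Iso t v := by
  induction h generalizing v with
  | node k l c c' σ h ih =>
    cases h' with
    | node _ _ _ c'' σ' h' =>
      exact .node k l c c'' (σ' * σ) fun j => ih j (h' (σ j))

instance setoid : Setoid OTree := ⟨Iso, Iso.refl, Iso.symm, Iso.trans⟩

/-- The colour of the root. -/
def root : OTree → Fin 2
  | node k _ _ => k

/-- `ρ(t)`, the number of nodes. -/
def order : OTree → ℕ
  | node _ _ c => 1 + ∑ j, (c j).order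

/-- `γ(t)`, the density: `γ([t₁,…,t_l]_k) = ρ([t₁,…,t_l]_k) γ(t₁) ⋯ γ(t_l)`. -/
def density : OTree → ℕ
  | node _ _ c => (1 + ∑ j, (c j).order) * ∏ j, (c j).density

/-- The nodes of a tree: `none` is the root, `some ⟨j, v⟩` is the node `v` of the `j`-th subtree. -/
def Vertex : OTree → Type
  | node _ l c => Option (Σ j : Fin l, (c j).Vertex)

/-- The parent of a node (`none` for the root). -/
def parent : (t : OTree) → t.Vertex → Option t.Vertex
  | node _ _ _, none => none
  | node _ _ c, some ⟨j, v⟩ => some (((c j).parent v).map fun u => ⟨j, u⟩)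

/-- The colour of a node. -/
def colour : (t : OTree) → t.Vertex → Fin 2
  | node k _ _, none => k
  | node _ _ c, some ⟨j, v⟩ => (c j).colour v

/-- The vector `Φ(t) ∈ ℝˢ` with respect to stage matrices `Z 0`, `Z 1`:
`Φ([t₁,…,t_l]_k) = ∏ⱼ Z_{kⱼ} Φ(tⱼ)` (componentwise product), with `kⱼ` the root colour of `tⱼ`.
For a single node it is the vector of ones. -/
def weight {s : ℕ} (Z : Fin 2 → Matrix (Fin s) (Fin s) ℝ) : OTree → Fin s → ℝ
  | node _ _ c => fun i => ∏ j, (Z (c j).root *ᵥ (c j).weight Z) i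

/-- The elementary differential `F([t₁,…,t_l]_k)(y) = g_k^{(l)}(y)(F(t₁)(y), …, F(t_l)(y))`. -/
noncomputable def elemDiff {E : Type*} [NormedAddCommGroup E] [NormedSpace ℝ E]
    (g : Fin 2 → E → E) : OTree → E → E
  | node k l c => fun y => iteratedFDeriv ℝ l (g k) y fun j => (c j).elemDiff g y

theorem Iso.root_eq {t u : OTree} (h : Iso t u) : t.root = u.root := by
  cases h; rfl

theorem Iso.order_eq {t u : OTree} (h : Iso t u) : t.order = u.order := by
  induction h with
  | node k l c c' σ h ih =>
    simp only [order, ih]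
    rw [Equiv.sum_comp σ fun j => (c' j).order]

theorem Iso.density_eq {t u : OTree} (h : Iso t u) : t.density = u.density := by
  induction h with
  | node k l c c' σ h ih =>
    simp only [density, ih, fun j => (h j).order_eq]
    rw [Equiv.sum_comp σ fun j => (c' j).order, Equiv.prod_comp σ fun j => (c' j).density]

theorem Iso.weight_eq {s : ℕ} (Z : Fin 2 → Matrix (Fin s) (Fin s) ℝ) {t u : OTree}
    (h : Iso t u) : t.weight Z = u.weight Z := by
  induction h with
  | node k l c c' σ h ih =>
    funext i
    simp only [weight, ih, fun j => (h j).root_eq]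
    rw [Equiv.prod_comp σ fun j => (Z (c' j).root *ᵥ (c' j).weight Z) i]

theorem Iso.elemDiff_eq {E : Type*} [NormedAddCommGroup E] [NormedSpace ℝ E]
    {g : Fin 2 → E → E} (hg : ∀ k, ContDiff ℝ ∞ (g k)) {t u : OTree}
    (h : Iso t u) : t.elemDiff g = u.elemDiff g := by
  induction h with
  | node k l c c' σ h ih =>
    funext y
    simp only [elemDiff, ih]
    exact iteratedFDeriv_comp_perm (hg k) l σ y fun j => (c' j).elemDiff g y

theorem finite_order_le (N : ℕ) : {t : OTree | t.order ≤ N}.Finite := by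
  induction N with
  | zero =>
    refine Set.Finite.subset Set.finite_empty ?_
    rintro ⟨k, l, c⟩ h
    simp [order] at h
  | succ N ih =>
    have hl : ∀ l : ℕ, {c : Fin l → OTree | ∀ j, (c j).order ≤ N}.Finite := fun l => by
      have := Set.Finite.pi (fun _ : Fin l => ih)
      simpa [Set.pi] using this
    have hfin : (⋃ k : Fin 2, ⋃ l ∈ Finset.range (N + 1),
        (fun c : Fin l → OTree => node k l c) '' {c | ∀ j, (c j).order ≤ N}).Finite :=
      Set.finite_iUnion fun k => Set.Finite.biUnion (Finset.finite_toSet _) fun l _ =>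
        (hl l).image _
    refine hfin.subset ?_
    rintro ⟨k, l, c⟩ h
    have h1 : ∑ j, (c j).order ≤ N := by
      simp only [Set.mem_ofPred_eq, order] at h
      omega
    have hpos : ∀ t : OTree, 1 ≤ t.order := by
      rintro ⟨k, l, c⟩
      simp [order]
    have h2 : l ≤ N := by
      calc l = ∑ _j : Fin l, 1 := by simp
        _ ≤ ∑ j, (c j).order := Finset.sum_le_sum fun j _ => hpos _
        _ ≤ N := h1
    simp only [Set.mem_iUnion, Finset.mem_range]
    refine ⟨k, l, by omega, c, fun j => ?_, rfl⟩
    exact (Finset.single_le_sum (f := fun j => (c j).order)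
      (fun _ _ => Nat.zero_le _) (Finset.mem_univ j)).trans h1

end OTree

/-- `Γ`: (unordered) rooted trees with coloured nodes, that is, isomorphism classes. -/
def Tree : Type := Quotient OTree.setoid

namespace Tree

/-- The colour of the root. -/
def root : Tree → Fin 2 := Quotient.lift OTree.root fun _ _ h => OTree.Iso.root_eq h

/-- `ρ(ι)`, the number of nodes. -/
def order : Tree → ℕ := Quotient.lift OTree.order fun _ _ h => OTree.Iso.order_eq h

/-- The density `γ(ι)`. -/
def density : Tree → ℕ := Quotient.lift OTree.density fun _ _ h => OTree.Iso.density_eq h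

/-- The vector `Φ(ι)`. -/
def weight {s : ℕ} (Z : Fin 2 → Matrix (Fin s) (Fin s) ℝ) : Tree → Fin s → ℝ :=
  Quotient.lift (OTree.weight Z) fun _ _ h => OTree.Iso.weight_eq Z h

/-- The elementary differential `F(ι)`, evaluated on a representative; for smooth `g 0`, `g 1`
the choice of the representative does not matter (`elemDiff_mk`). -/
noncomputable def elemDiff {E : Type*} [NormedAddCommGroup E] [NormedSpace ℝ E]
    (g : Fin 2 → E → E) (ι : Tree) : E → E :=
  OTree.elemDiff g (Quotient.out ι)

theorem elemDiff_mk {E : Type*} [NormedAddCommGroup E] [NormedSpace ℝ E]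
    {g : Fin 2 → E → E} (hg : ∀ k, ContDiff ℝ ∞ (g k)) (t : OTree) :
    elemDiff g (Quotient.mk OTree.setoid t) = t.elemDiff g :=
  OTree.Iso.elemDiff_eq hg (Quotient.mk_out (s := OTree.setoid) t)

/-- The set of monotonically labelled versions of `ι`: the coloured trees with node set
`{0, …, ρ(ι) - 1}`, given by the parent and the colour of each node, that are isomorphic to `ι`
and in which the label of each node exceeds the label of its parent. -/
def monotoneLabelings (ι : Tree) :
    Set ((Fin ι.order → Option (Fin ι.order)) × (Fin ι.order → Fin 2)) :=
  {L | (∀ i j, L.1 i = some j → j < i) ∧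
    ∃ t : OTree, Quotient.mk OTree.setoid t = ι ∧ ∃ e : t.Vertex ≃ Fin ι.order,
      ∀ v, L.1 (e v) = (t.parent v).map e ∧ L.2 (e v) = t.colour v}

/-- `α(ι)`, the number of different monotonic labelings of `ι`. -/
noncomputable def numLabelings (ι : Tree) : ℕ := ι.monotoneLabelings.ncard

/-- `ω(ι) = α(ι) γ(ι) / ρ(ι)!`. -/
noncomputable def omega (ι : Tree) : ℝ :=
  (ι.numLabelings : ℝ) * (ι.density : ℝ) / (Nat.factorial ι.order : ℝ)

theorem finite_order_le (N : ℕ) : {ι : Tree | ι.order ≤ N}.Finite := by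
  refine ((OTree.finite_order_le N).image (Quotient.mk OTree.setoid)).subset ?_
  intro ι
  induction ι using Quotient.inductionOn with
  | h t => exact fun h => ⟨t, h, rfl⟩

end Tree

/-- `Γ_k`: the trees with a root of colour `k`. -/
def Γ (k : Fin 2) : Set Tree := {ι | ι.root = k}

theorem finite_pairs (k k' : Fin 2) (N : ℕ) :
    {p : Γ k × Γ k' | p.1.1.order + p.2.1.order ≤ N}.Finite := by
  have h1 : ∀ k : Fin 2, {x : Γ k | x.1.order ≤ N}.Finite := fun k =>
    (Tree.finite_order_le N).preimage Subtype.val_injective.injOn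
  refine ((h1 k).prod (h1 k')).subset ?_
  intro p hp
  simp only [Set.mem_ofPred_eq] at hp
  constructor <;> simp only [Set.mem_ofPred_eq] <;> omega

/-- The pairs `(ι, ι') ∈ Γ_k × Γ_k'` with at most `N` nodes altogether. -/
noncomputable def pairs (k k' : Fin 2) (N : ℕ) : Finset (Γ k × Γ k') :=
  (finite_pairs k k' N).toFinset

/-! ### Quadratic invariants -/

/-- `I` is an invariant of the Stratonovich equation `dy = f(y) dt + g(y) ∘ dW`. -/
def IsInvariant {d : ℕ} (f g : EuclideanSpace ℝ (Fin d) → EuclideanSpace ℝ (Fin d))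
    (I : EuclideanSpace ℝ (Fin d) → ℝ) : Prop :=
  Differentiable ℝ I ∧ ∀ y, inner ℝ (gradient I y) (f y) = 0 ∧ inner ℝ (gradient I y) (g y) = 0

/-- The bilinear form `xᵀ C y`. -/
def bilin {d : ℕ} (C : Matrix (Fin d) (Fin d) ℝ) (x y : EuclideanSpace ℝ (Fin d)) : ℝ :=
  x.ofLp ⬝ᵥ C *ᵥ y.ofLp

/-- `I(y) = yᵀ C y`. -/
def quad {d : ℕ} (C : Matrix (Fin d) (Fin d) ℝ) (y : EuclideanSpace ℝ (Fin d)) : ℝ :=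
  bilin C y y

/-- `C` is symmetric and `yᵀ C y` is an invariant of `dy = f(y) dt + g(y) ∘ dW`. -/
def IsQuadraticInvariant {d : ℕ} (f g : EuclideanSpace ℝ (Fin d) → EuclideanSpace ℝ (Fin d))
    (C : Matrix (Fin d) (Fin d) ℝ) : Prop :=
  C.IsSymm ∧ IsInvariant f g (quad C)

/-! ### Stochastic Runge–Kutta methods -/

/-- The stage equations of one step with step size `h` and increment `w = ΔW`:
`Y_i = y + h ∑ⱼ a_{ij} f(Y_j) + w ∑ⱼ b_{ij} g(Y_j)`. -/
def StageEq {d s : ℕ} (f g : EuclideanSpace ℝ (Fin d) → EuclideanSpace ℝ (Fin d))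
    (A B : Matrix (Fin s) (Fin s) ℝ) (h w : ℝ) (y : EuclideanSpace ℝ (Fin d))
    (Y : Fin s → EuclideanSpace ℝ (Fin d)) : Prop :=
  ∀ i, Y i = y + h • ∑ j, A i j • f (Y j) + w • ∑ j, B i j • g (Y j)

/-- The increment `ΔW_n = W(t_{n+1}) - W(t_n)`, `t_n = n h`, of a path `W`. -/
def incr (W : ℝ → ℝ) (h : ℝ) (n : ℕ) : ℝ := W ((n + 1 : ℕ) * h) - W (n * h)

/-- `y_0, …, y_{N_T}`, with stages `Y_{n,i}`, is produced by the stochastic Runge–Kutta method with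
tableau `A, B, α, β` and step size `h` along the path `W`. -/
def IsSRKSolution {d s : ℕ} (f g : EuclideanSpace ℝ (Fin d) → EuclideanSpace ℝ (Fin d))
    (A B : Matrix (Fin s) (Fin s) ℝ) (α β : Fin s → ℝ) (h : ℝ) (NT : ℕ) (W : ℝ → ℝ)
    (y : ℕ → EuclideanSpace ℝ (Fin d)) (Y : ℕ → Fin s → EuclideanSpace ℝ (Fin d)) : Prop :=
  ∀ n < NT, StageEq f g A B h (incr W h n) (y n) (Y n) ∧
    y (n + 1) = y n + h • ∑ i, α i • f (Y n i) + incr W h n • ∑ i, β i • g (Y n i)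

/-- `M⁰` (for `A, α`) and `M¹` (for `B, β`): `diag(α) A + Aᵀ diag(α) - α αᵀ`. -/
def MDiag {s : ℕ} (A : Matrix (Fin s) (Fin s) ℝ) (α : Fin s → ℝ) : Matrix (Fin s) (Fin s) ℝ :=
  Matrix.diagonal α * A + Aᵀ * Matrix.diagonal α - Matrix.vecMulVec α α

/-- `M* = diag(α) B + Aᵀ diag(β) - α βᵀ`. -/
def MStar {s : ℕ} (A B : Matrix (Fin s) (Fin s) ℝ) (α β : Fin s → ℝ) :
    Matrix (Fin s) (Fin s) ℝ :=
  Matrix.diagonal α * B + Aᵀ * Matrix.diagonal β - Matrix.vecMulVec α β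

/-- The vector `Φ(ι)` of a step with step size `h` and increment `w`: a non-root node contributes
the matrix `h A` if it is deterministic and `w B` if it is stochastic. -/
def Phi {s : ℕ} (A B : Matrix (Fin s) (Fin s) ℝ) (h w : ℝ) (ι : Tree) : Fin s → ℝ :=
  ι.weight ![h • A, w • B]

/-- The term `ω(ι) ω(ι') (z_k Φ(ι))ᵀ M (z_{k'} Φ(ι')) (F(ι)(y)ᵀ C F(ι')(y))`, with `z_0 = h` and
`z_1 = w`, of the double series over `ι ∈ Γ_k`, `ι' ∈ Γ_{k'}`. -/
noncomputable def term {d s : ℕ} (f g : EuclideanSpace ℝ (Fin d) → EuclideanSpace ℝ (Fin d))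
    (C : Matrix (Fin d) (Fin d) ℝ) (A B : Matrix (Fin s) (Fin s) ℝ)
    (M : Matrix (Fin s) (Fin s) ℝ) (h w : ℝ) (y : EuclideanSpace ℝ (Fin d)) (k k' : Fin 2)
    (p : Γ k × Γ k') : ℝ :=
  p.1.1.omega * p.2.1.omega *
    ((![h, w] k • Phi A B h w p.1.1) ⬝ᵥ M *ᵥ (![h, w] k' • Phi A B h w p.2.1)) *
    bilin C (p.1.1.elemDiff ![f, g] y) (p.2.1.elemDiff ![f, g] y)

end SRK

namespace SRK

namespace OTree

/-! ### Counting monotone labelings: the hook length formula -/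

/-! The argument joins an exact algebraic identity to a B-series expansion.

Since `C` is symmetric, invariance says that `f(y)` and `g(y)` are `C`-orthogonal to `y`, for every
`y`. Expand `I(y_{n+1})` and eliminate the mixed products of `y_n` with the stage values by means of
the stage equations and orthogonality at `Y_{n,i}`. The defect becomes exactly a combination of the
products of `f(Y_i)`, `g(Y_i)` under `C`, with coefficient matrices `M⁰`, `M*`, `M¹`
(`quad_step_sub`). It remains to insert the B-series of `f(Y_i)` and `g(Y_i)`.

These series are first built over plane trees, with weight `∏ 1 / l_v!`. Multilinearity of the
derivatives turns the Taylor polynomial of `g_k`, evaluated at a truncated stage series, into a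
finite sum over grafted trees (`bterm_node`, `sum_grafts_bterm`). For smooth coefficients the
expansion is bootstrapped: an error of order `N` in `g_k(Y_i)` gives order `N + 1` in `Y_i`, hence
again in `g_k(Y_i)` (`exists_expansion_bound`). For analytic coefficients, uniform Cauchy estimates
majorise the series by the generating function of plane trees. Its sum solves the stage equations
(`exists_hasSum_bterm`), and uniqueness of small solutions, a contraction argument, identifies it
with the given stages.

The passage to isomorphism classes needs the plane weights in a class `ι` to add up to `ω(ι)`
(`sum_coeff_eq_omega`). Count plane trees of shape `ι` with a monotone bijective labelling in two
ways. Each plane tree has `ρ! / γ` such labellings, by the hook length formula, and each of the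
`α(ι)` labelled unordered trees has `∏ l_v!` plane realisations. Hence the number of plane
representatives divided by `∏ l_v!` is `α γ / ρ!`. -/

theorem finite_vertex (t : OTree) : Finite t.Vertex := by
  induction t with
  | node k l c ih =>
    have := ih
    exact inferInstanceAs (Finite (Option (Σ j : Fin l, (c j).Vertex)))

instance (t : OTree) : Finite t.Vertex := finite_vertex t

theorem card_vertex (t : OTree) : Nat.card t.Vertex = t.order := by
  induction t with
  | node k l c ih =>
    change Nat.card (Option (Σ j : Fin l, (c j).Vertex)) = _
    rw [Finite.card_option, Nat.card_sigma, order, add_comm]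
    simp only [ih]

/-- Induction along the parent map of a tree. -/
theorem vertex_induction (t : OTree) {P : t.Vertex → Prop}
    (h0 : ∀ v, t.parent v = none → P v)
    (h1 : ∀ v u, t.parent v = some u → P u → P v) : ∀ v, P v := by
  induction t with
  | node k l c ih =>
    have hroot : P (none : Option (Σ j : Fin l, (c j).Vertex)) := h0 _ rfl
    rintro (_ | ⟨j, v⟩)
    · exact hroot
    · refine ih j (P := fun v => P (some ⟨j, v⟩ : Option (Σ j : Fin l, (c j).Vertex))) ?_ ?_ v
      · intro v hv
        refine h1 _ (none : Option (Σ j : Fin l, (c j).Vertex)) ?_ hroot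
        simp [parent, hv]
      · intro v u hv hu
        refine h1 _ (some ⟨j, u⟩ : Option (Σ j : Fin l, (c j).Vertex)) ?_ hu
        simp [parent, hv]

/-- The key of every vertex exceeds the key of its parent. -/
def Mono (t : OTree) (key : t.Vertex → ℕ) : Prop :=
  ∀ v u, t.parent v = some u → key u < key v

/-- Following parents from any node of a subtree ends at the root of the whole tree, so keys that
increase along edges put the root strictly below everything. This is what makes recursion over the
subtrees possible. -/
theorem mono_node_iff {k : Fin 2} {l : ℕ} {c : Fin l → OTree}
    {key : Option (Σ j : Fin l, (c j).Vertex) → ℕ} :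
    (node k l c).Mono key ↔ (∀ j v, key none < key (some ⟨j, v⟩)) ∧
      ∀ j, (c j).Mono fun v => key (some ⟨j, v⟩) := by
  constructor
  · intro h
    have hc : ∀ j, (c j).Mono fun v => key (some ⟨j, v⟩) := by
      intro j v u hv
      refine h (some ⟨j, v⟩ : Option (Σ j : Fin l, (c j).Vertex))
        (some ⟨j, u⟩ : Option (Σ j : Fin l, (c j).Vertex)) ?_
      simp [parent, hv]
    refine ⟨fun j => ?_, hc⟩
    refine (c j).vertex_induction ?_ ?_
    · intro v hv
      refine h (some ⟨j, v⟩ : Option (Σ j : Fin l, (c j).Vertex))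
        (none : Option (Σ j : Fin l, (c j).Vertex)) ?_
      simp [parent, hv]
    · intro v u hv hu
      exact hu.trans (hc j v u hv)
  · rintro ⟨h0, h1⟩ (_ | ⟨j, v⟩) u hu
    · simp [parent] at hu
    · cases hp : (c j).parent v with
      | none =>
        simp only [parent, hp, Option.map_none] at hu
        obtain rfl := Option.some.inj hu
        exact h0 j v
      | some u' =>
        simp only [parent, hp, Option.map_some] at hu
        obtain rfl := Option.some.inj hu
        exact h1 j v u' hp

/-- The hook length formula for rooted trees. -/
theorem card_mono_mul_density (t : OTree) : ∀ (X : Type) [Finite X] (key : X → ℕ),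
    Function.Injective key → Nat.card X = t.order →
    Nat.card {e : t.Vertex ≃ X // t.Mono (key ∘ e)} * t.density = Nat.factorial t.order := by
  classical
  induction t with
  | node k l c ih =>
    intro X _ key hkey hX
    let S := Σ j : Fin l, (c j).Vertex
    have hS : Nat.card S = ∑ j, (c j).order := by
      rw [Nat.card_sigma]; simp only [card_vertex]
    have : Nonempty X := by
      apply (Nat.card_pos_iff.1 _).1
      rw [hX, order]; omega
    obtain ⟨m, hm⟩ := Finite.exists_min key
    let X' := {x : X // x ≠ m}
    have hX' : Nat.card X' = ∑ j, (c j).order := by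
      have h1 : Nat.card (Option X') = Nat.card X := Nat.card_congr (Equiv.optionSubtypeNe m)
      rw [Finite.card_option, hX, order] at h1
      omega
    -- The monotonicity condition on the forest left when the root is removed.
    let FM : (S ≃ X') → Prop := fun e => ∀ j, (c j).Mono fun v => key (e ⟨j, v⟩)
    -- the root carries the least key
    have hcard1 : Nat.card {e : Option S ≃ X // (node k l c).Mono (key ∘ e)} =
        Nat.card {e : S ≃ X' // FM e} := by
      have h1 : Nat.card {e : Option S ≃ X // (node k l c).Mono (key ∘ e)} =
          Nat.card {e : {e : Option S ≃ X // e none = m} // FM (Equiv.optionSubtype m e)} := by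
        refine Nat.card_congr ?_
        refine (Equiv.subtypeEquivRight ?_).trans
          (Equiv.subtypeSubtypeEquivSubtypeExists _ _).symm
        intro e
        refine Iff.trans (mono_node_iff (key := key ∘ e)) ?_
        constructor
        · rintro ⟨h0, h1⟩
          have hn : e none = m := by
            obtain ⟨v, hv⟩ := e.surjective m
            rcases v with _ | ⟨j, v⟩
            · exact hv
            · have h2 := h0 j v
              simp only [Function.comp, hv] at h2
              exact absurd (hm (e none)) (by omega)
          exact ⟨hn, h1⟩
        · rintro ⟨hn, h1⟩
          refine ⟨fun j v => ?_, h1⟩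
          refine lt_of_le_of_ne ?_ ?_
          · simp only [Function.comp, hn]
            exact hm _
          · simp only [Function.comp]
            intro h
            have := e.injective (hkey h)
            simp at this
      rw [h1]
      exact Nat.card_congr ((Equiv.optionSubtype m).subtypeEquiv fun e => Iff.rfl)
    let e0 : S ≃ X' := (Finite.equivFinOfCardEq hS).trans (Finite.equivFinOfCardEq hX').symm
    let Q := ∀ j, Equiv.Perm (c j).Vertex
    have hQ : Nat.card Q = ∏ j, Nat.factorial (c j).order := by
      rw [Nat.card_pi]
      simp only [Nat.card_perm, card_vertex]
    have hE : Nat.card (S ≃ X') = Nat.factorial (∑ j, (c j).order) := by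
      rw [← hS, ← Nat.card_perm]
      exact Nat.card_congr (Equiv.equivCongr (Equiv.refl S) e0.symm)
    -- Double counting: `A` consists of pairs of a bijection `e` and a shuffle `π` inside the
    -- subtrees such that `e ∘ π` is monotone. The substitution `e ↦ e ∘ π` makes the number of
    -- admissible `π` drop out as a free factor. For fixed `e`, however, the condition splits over
    -- the subtrees and the induction hypothesis applies to each.
    let A := {x : (S ≃ X') × Q // FM ((Equiv.sigmaCongrRight x.2).trans x.1)}
    have hA1 : Nat.card A = Nat.card {e : S ≃ X' // FM e} * Nat.card Q := by
      rw [← Nat.card_prod]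
      refine Nat.card_congr ?_
      let T : (S ≃ X') × Q ≃ (S ≃ X') × Q :=
        { toFun := fun x => ((Equiv.sigmaCongrRight x.2).trans x.1, x.2)
          invFun := fun x => ((Equiv.sigmaCongrRight x.2).symm.trans x.1, x.2)
          left_inv := fun x => by
            refine Prod.ext (Equiv.ext fun v => congrArg x.1 ?_) rfl
            exact (Equiv.sigmaCongrRight x.2).apply_symm_apply v
          right_inv := fun x => by
            refine Prod.ext (Equiv.ext fun v => congrArg x.1 ?_) rfl
            exact (Equiv.sigmaCongrRight x.2).symm_apply_apply v }
      exact (T.subtypeEquiv (q := fun x => FM x.1) fun x => Iff.rfl).trans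
        Equiv.prodSubtypeFstEquivSubtypeProd
    have hA2 : Nat.card A * ∏ j, (c j).density =
        Nat.factorial (∑ j, (c j).order) * ∏ j, Nat.factorial (c j).order := by
      have e1 : A ≃ Σ e : S ≃ X', {π : Q // FM ((Equiv.sigmaCongrRight π).trans e)} :=
        Equiv.subtypeProdEquivSigmaSubtype
          (fun (e : S ≃ X') (π : Q) => FM ((Equiv.sigmaCongrRight π).trans e))
      have : Fintype (S ≃ X') := Fintype.ofFinite _
      rw [Nat.card_congr e1, Nat.card_sigma, Finset.sum_mul]
      have hconst : ∀ e : S ≃ X',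
          Nat.card {π : Q // FM ((Equiv.sigmaCongrRight π).trans e)} * ∏ j, (c j).density =
            ∏ j, Nat.factorial (c j).order := by
        intro e
        have e2 : {π : Q // FM ((Equiv.sigmaCongrRight π).trans e)} ≃
            ∀ j, {π : Equiv.Perm (c j).Vertex //
              (c j).Mono ((fun v => key (e ⟨j, v⟩)) ∘ π)} :=
          Equiv.subtypePiEquivPi (p := fun j (π : Equiv.Perm (c j).Vertex) =>
            (c j).Mono ((fun v => key (e ⟨j, v⟩)) ∘ π))
        rw [Nat.card_congr e2, Nat.card_pi, ← Finset.prod_mul_distrib]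
        refine Finset.prod_congr rfl fun j _ => ?_
        -- The keys that `e` gives to one subtree form an arbitrary injective family; this is why
        -- the induction runs over all key sets `X`.
        refine ih j (c j).Vertex (fun v => key (e ⟨j, v⟩)) ?_ (card_vertex _)
        intro v v' h
        exact eq_of_heq (Sigma.mk.inj (e.injective (Subtype.ext (hkey h)))).2
      rw [Finset.sum_congr rfl fun e _ => hconst e, Finset.sum_const, smul_eq_mul,
        Finset.card_univ, ← Nat.card_eq_fintype_card, hE]
    have hpos : 0 < ∏ j, Nat.factorial (c j).order :=
      Finset.prod_pos fun j _ => Nat.factorial_pos _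
    have hF : Nat.card {e : S ≃ X' // FM e} * ∏ j, (c j).density =
        Nat.factorial (∑ j, (c j).order) := by
      rw [hA1, hQ] at hA2
      refine Nat.eq_of_mul_eq_mul_right hpos ?_
      rw [← hA2]; ring
    change Nat.card {e : Option S ≃ X // (node k l c).Mono (key ∘ e)} * _ = _
    rw [hcard1, density, order, add_comm 1, Nat.factorial_succ, ← hF]
    ring

/-! ### Isomorphisms as bijections between the nodes -/

/-- Bijections between the nodes that respect parents and colours. -/
def VIso (t u : OTree) : Type :=
  {e : t.Vertex ≃ u.Vertex // ∀ v, u.parent (e v) = (t.parent v).map e ∧ u.colour (e v) = t.colour v}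

/-- The number of ways of ordering the subtrees at all nodes. -/
def orderings : OTree → ℕ
  | node _ l c => Nat.factorial l * ∏ j, (c j).orderings

theorem Iso.orderings_eq {t u : OTree} (h : Iso t u) : t.orderings = u.orderings := by
  induction h with
  | node k l c c' σ h ih =>
    simp only [orderings, ih]
    rw [Equiv.prod_comp σ fun j => (c' j).orderings]

theorem orderings_pos (t : OTree) : 0 < t.orderings := by
  induction t with
  | node k l c ih =>
    exact Nat.mul_pos (Nat.factorial_pos _) (Finset.prod_pos fun j _ => ih j)

/-- The bijection of nodes assembled from bijections between the subtrees. -/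
def assemble {l : ℕ} {c c' : Fin l → OTree} (σ : Equiv.Perm (Fin l))
    (e : ∀ j, (c j).Vertex ≃ (c' (σ j)).Vertex) :
    Option (Σ j : Fin l, (c j).Vertex) ≃ Option (Σ j : Fin l, (c' j).Vertex) :=
  Equiv.optionCongr ((Equiv.sigmaCongrRight e).trans
    (Equiv.sigmaCongrLeft (β := fun j => (c' j).Vertex) σ))

/-- An isomorphism of trees assembled from isomorphisms of the subtrees. -/
def VIso.assemble (k : Fin 2) {l : ℕ} {c c' : Fin l → OTree} (σ : Equiv.Perm (Fin l))
    (e : ∀ j, VIso (c j) (c' (σ j))) : VIso (node k l c) (node k l c') :=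
  ⟨OTree.assemble σ fun j => (e j).1, by
    rintro (_ | ⟨j, v⟩)
    · exact ⟨rfl, rfl⟩
    · refine ⟨?_, ((e j).2 v).2⟩
      have h := ((e j).2 v).1
      change (some (((c' (σ j)).parent ((e j).1 v)).map fun u => (⟨σ j, u⟩ : Σ j, (c' j).Vertex)) :
        Option (Option (Σ j, (c' j).Vertex))) = _
      rw [h]
      change _ = Option.map (OTree.assemble σ fun j => (e j).1)
        (some (((c j).parent v).map fun u => (⟨j, u⟩ : Σ j, (c j).Vertex)))
      cases (c j).parent v <;> rfl⟩

end OTree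
end SRK

/-! ### Decomposition of isomorphisms at the root, and their number -/

namespace SRK

namespace OTree

/-- The root, as a node of the tree. -/
def rootVertex : (t : OTree) → t.Vertex
  | node _ l c => (none : Option (Σ j : Fin l, (c j).Vertex))

theorem parent_eq_none_iff {t : OTree} {v : t.Vertex} : t.parent v = none ↔ v = t.rootVertex := by
  cases t with
  | node k l c =>
    rcases v with _ | ⟨j, v⟩
    · exact ⟨fun _ => rfl, fun _ => rfl⟩
    · exact ⟨fun h => (Option.some_ne_none _ h).elim, fun h => (Option.some_ne_none _ h).elim⟩

theorem parent_some {k : Fin 2} {l : ℕ} {c : Fin l → OTree} (j : Fin l) (v : (c j).Vertex) :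
    (node k l c).parent (some ⟨j, v⟩ : Option (Σ j : Fin l, (c j).Vertex)) =
      (some (((c j).parent v).map fun u => ⟨j, u⟩) :
        Option (Option (Σ j : Fin l, (c j).Vertex))) := rfl

/-- The inverse of an isomorphism. -/
def VIso.symm {t u : OTree} (e : VIso t u) : VIso u t :=
  ⟨e.1.symm, fun v => by
    obtain ⟨h1, h2⟩ := e.2 (e.1.symm v)
    rw [e.1.apply_symm_apply] at h1 h2
    refine ⟨?_, h2.symm⟩
    rw [h1, Option.map_map]
    simp⟩

theorem VIso.map_root {t u : OTree} (e : VIso t u) : e.1 t.rootVertex = u.rootVertex := by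
  rw [← parent_eq_none_iff, (e.2 _).1, parent_eq_none_iff.2 rfl]
  rfl

/-- The root goes to the root, so no other node does. Within a subtree, passing from a node to its
parent does not change the branch containing the image, so all nodes land in the branch that
receives the subtree's root. -/
theorem VIso.exists_index {k k' : Fin 2} {l l' : ℕ} {c : Fin l → OTree} {c' : Fin l' → OTree}
    (e : VIso (node k l c) (node k' l' c')) (j : Fin l) :
    ∃ j' : Fin l', ∀ v : (c j).Vertex, ∃ v' : (c' j').Vertex,
      e.1 (some ⟨j, v⟩ : Option (Σ j : Fin l, (c j).Vertex)) =
        (some ⟨j', v'⟩ : Option (Σ j : Fin l', (c' j).Vertex)) := by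
  have hne : ∀ v : (c j).Vertex, ∃ x : Σ j : Fin l', (c' j).Vertex,
      e.1 (some ⟨j, v⟩ : Option (Σ j : Fin l, (c j).Vertex)) =
        (some x : Option (Σ j : Fin l', (c' j).Vertex)) := by
    intro v
    refine Option.ne_none_iff_exists'.1 fun h => ?_
    have := e.1.injective (h.trans e.map_root.symm)
    exact Option.some_ne_none _ this
  choose E hE using hne
  refine ⟨(E (c j).rootVertex).1, ?_⟩
  have hfst : ∀ v, (E v).1 = (E (c j).rootVertex).1 := by
    refine (c j).vertex_induction ?_ ?_
    · intro v hv
      rw [parent_eq_none_iff.1 hv]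
    · intro v u hv hu
      rw [← hu]
      have h := (e.2 (some ⟨j, v⟩ : Option (Σ j : Fin l, (c j).Vertex))).1
      rw [parent_some, hv] at h
      rw [hE v] at h
      have h2 : (some (((c' (E v).1).parent (E v).2).map fun u => ⟨(E v).1, u⟩) :
          Option (Option (Σ j : Fin l', (c' j).Vertex))) = some (some (E u)) := by
        rw [← hE u]; exact h
      have h3 := Option.some.inj h2
      obtain ⟨w, -, hw⟩ := Option.map_eq_some_iff.1 h3
      rw [← hw]
  intro v
  rw [hE v]
  have := hfst v
  rcases h : E v with ⟨j', v'⟩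
  rw [h] at this
  subst this
  exact ⟨v', rfl⟩

/-- The branch indices of `e` and of its inverse are mutually inverse, which gives the permutation
and forces equal arities. The restrictions to the branches are then bijections that respect parents
and colours. The equality lives in the sigma type because the form of `u` is part of the conclusion.
-/
theorem VIso.exists_assemble {k : Fin 2} {l : ℕ} {c : Fin l → OTree} {u : OTree}
    (e : VIso (node k l c) u) :
    ∃ (c' : Fin l → OTree) (σ : Equiv.Perm (Fin l)) (φ : ∀ j, VIso (c j) (c' (σ j))),
      (⟨u, e⟩ : Σ u, VIso (node k l c) u) = ⟨node k l c', VIso.assemble k σ φ⟩ := by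
  rcases u with ⟨k', l', c'⟩
  have hroot := e.map_root
  have hk : k' = k := by
    have h := (e.2 (node k l c).rootVertex).2
    rw [hroot] at h
    exact h
  subst hk
  choose σ φ hφ using e.exists_index
  choose τ ψ hψ using e.symm.exists_index
  have hτσ : ∀ j, τ (σ j) = j := by
    intro j
    have h1 := hψ (σ j) (φ j (c j).rootVertex)
    rw [← hφ] at h1
    have h2 := (e.1.symm_apply_apply _).symm.trans h1
    exact (Sigma.mk.inj (Option.some.inj h2)).1.symm
  have hστ : ∀ j, σ (τ j) = j := by
    intro j
    have h1 := hφ (τ j) (ψ j (c' j).rootVertex)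
    rw [← hψ] at h1
    have h2 := (e.1.apply_symm_apply _).symm.trans h1
    exact (Sigma.mk.inj (Option.some.inj h2)).1.symm
  let σ' : Fin l ≃ Fin l' := ⟨σ, τ, hτσ, hστ⟩
  have hl : l' = l := by simpa using (Fintype.card_congr σ').symm
  subst hl
  have hbij : ∀ j, Function.Bijective (φ j) := by
    intro j
    constructor
    · intro v v' h
      have h1 := (hφ j v).trans ((congrArg _ (by rw [h])).trans (hφ j v').symm)
      exact eq_of_heq (Sigma.mk.inj (Option.some.inj (e.1.injective h1))).2
    · intro u
      obtain ⟨x, hx⟩ := e.1.surjective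
        (some ⟨σ j, u⟩ : Option (Σ j : Fin l', (c' j).Vertex))
      rcases x with _ | ⟨j', v⟩
      · exact absurd (hx.symm.trans hroot) (Option.some_ne_none _)
      · rw [hφ] at hx
        have h1 := Sigma.mk.inj (Option.some.inj hx)
        have h2 : j' = j := by rw [← hτσ j', h1.1, hτσ]
        subst h2
        exact ⟨v, eq_of_heq h1.2⟩
  refine ⟨c', σ', fun j => ⟨Equiv.ofBijective (φ j) (hbij j), fun v => ?_⟩, ?_⟩
  · have h := e.2 (some ⟨j, v⟩ : Option (Σ j : Fin l', (c j).Vertex))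
    rw [hφ, parent_some] at h
    refine ⟨?_, h.2⟩
    have h1 := h.1
    rw [parent_some] at h1
    cases hp : (c j).parent v with
    | none =>
      rw [hp] at h1
      have h2 := Option.some.inj (h1.trans (congrArg some hroot))
      have h3 := Option.map_eq_none_iff.1 h2
      exact h3
    | some w =>
      rw [hp] at h1
      have h2 := Option.some.inj (h1.trans (congrArg some (hφ j w)))
      obtain ⟨x, hx, hxw⟩ := Option.map_eq_some_iff.1 h2
      have h3 := eq_of_heq (Sigma.mk.inj hxw).2
      rw [h3] at hx
      exact hx
  · congr 1
    refine Subtype.ext (Equiv.ext ?_)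
    rintro (_ | ⟨j, v⟩)
    · exact hroot
    · exact hφ j v

/-- Connects bijections of nodes, in which labellings are phrased, with the inductive relation that
defines `Tree`. -/
theorem VIso.iso {t : OTree} : ∀ {u : OTree}, VIso t u → Iso t u := by
  induction t with
  | node k l c ih =>
    intro u e
    obtain ⟨c', σ, φ, h⟩ := e.exists_assemble
    obtain ⟨rfl, -⟩ := Sigma.mk.inj h
    exact .node k l c c' σ fun j => ih j (φ j)

/-- The number of isomorphisms out of `t`, onto arbitrary plane trees. -/
theorem VIso.card_sigma (t : OTree) :
    Finite (Σ u, VIso t u) ∧ Nat.card (Σ u, VIso t u) = t.orderings := by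
  induction t with
  | node k l c ih =>
    -- Splitting at the root: an isomorphism out of the tree is a permutation of the branches with
    -- an isomorphism out of every branch.
    let X := Σ σ : Equiv.Perm (Fin l), Σ c' : Fin l → OTree, ∀ j, VIso (c j) (c' (σ j))
    let G : X → Σ u, VIso (node k l c) u := fun x => ⟨node k l x.2.1, VIso.assemble k x.1 x.2.2⟩
    have hG : Function.Bijective G := by
      constructor
      · rintro ⟨σ, c', φ⟩ ⟨τ, d, ψ⟩ h
        obtain ⟨h1, h2⟩ := Sigma.mk.inj h
        obtain ⟨-, -, h3⟩ := OTree.node.inj h1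
        obtain rfl := eq_of_heq h3
        have h4 := congrArg Subtype.val (eq_of_heq h2)
        have h5 : ∀ j v, (⟨σ j, (φ j).1 v⟩ : Σ j : Fin l, (c' j).Vertex) = ⟨τ j, (ψ j).1 v⟩ :=
          fun j v => Option.some.inj (congrArg
            (fun e : Option (Σ j : Fin l, (c j).Vertex) ≃ Option (Σ j : Fin l, (c' j).Vertex) =>
              e (some ⟨j, v⟩)) h4)
        -- Every branch has a root, so its image reveals where the permutation sends the branch.
        have h6 : σ = τ := Equiv.ext fun j => (Sigma.mk.inj (h5 j (c j).rootVertex)).1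
        subst h6
        have h7 : φ = ψ := by
          funext j
          exact Subtype.ext (Equiv.ext fun v => eq_of_heq (Sigma.mk.inj (h5 j v)).2)
        rw [h7]
      · rintro ⟨u, e⟩
        obtain ⟨c', σ, φ, h⟩ := e.exists_assemble
        exact ⟨⟨σ, c', φ⟩, h.symm⟩
    let P : (Σ d : Fin l → OTree, ∀ j, VIso (c j) (d j)) ≃ ∀ j, Σ u, VIso (c j) u :=
      { toFun := fun x j => ⟨x.1 j, x.2 j⟩
        invFun := fun y => ⟨fun j => (y j).1, fun j => (y j).2⟩
        left_inv := fun _ => rfl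
        right_inv := fun _ => rfl }
    -- For fixed `σ` the family `c' ∘ σ` is arbitrary, so after reindexing the choices in different
    -- branches are independent. This yields `l!` times the product over the branches.
    let H : ∀ σ : Equiv.Perm (Fin l), (Σ c' : Fin l → OTree, ∀ j, VIso (c j) (c' (σ j))) ≃
        ∀ j, Σ u, VIso (c j) u := fun σ =>
      (Equiv.sigmaCongrLeft (β := fun d : Fin l → OTree => ∀ j, VIso (c j) (d j))
        (Equiv.arrowCongr σ.symm (Equiv.refl OTree))).trans P
    let J : (Σ u, VIso (node k l c) u) ≃ Equiv.Perm (Fin l) × ∀ j, Σ u, VIso (c j) u :=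
      (Equiv.ofBijective G hG).symm.trans
        ((Equiv.sigmaCongrRight H).trans (Equiv.sigmaEquivProd _ _))
    have := fun j => (ih j).1
    refine ⟨Finite.of_equiv _ J.symm, ?_⟩
    rw [Nat.card_congr J, Nat.card_prod, Nat.card_perm, Nat.card_pi, orderings]
    simp only [fun j => (ih j).2, Nat.card_eq_fintype_card, Fintype.card_fin]

/-- The weight `∏ 1 / l_v!` of a plane tree, `l_v` being the number of children of the node `v`. -/
noncomputable def coeff (t : OTree) : ℝ := (t.orderings : ℝ)⁻¹

theorem coeff_node (k : Fin 2) (l : ℕ) (c : Fin l → OTree) :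
    (node k l c).coeff = (Nat.factorial l : ℝ)⁻¹ * ∏ j, (c j).coeff := by
  simp [coeff, orderings, Finset.prod_inv_distrib, mul_comm]

theorem coeff_pos (t : OTree) : 0 < t.coeff :=
  inv_pos.2 (by exact_mod_cast t.orderings_pos)

/-- The parents and colours of the labels when the nodes of `t` are labelled through `e`. -/
def labelled (t : OTree) {n : ℕ} (e : t.Vertex ≃ Fin n) :
    (Fin n → Option (Fin n)) × (Fin n → Fin 2) :=
  (fun i => (t.parent (e.symm i)).map e, fun i => t.colour (e.symm i))

theorem labelled_eq_iff {t : OTree} {n : ℕ} {e : t.Vertex ≃ Fin n}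
    {L : (Fin n → Option (Fin n)) × (Fin n → Fin 2)} :
    t.labelled e = L ↔ ∀ v, L.1 (e v) = (t.parent v).map e ∧ L.2 (e v) = t.colour v := by
  constructor
  · rintro rfl v
    simp [labelled]
  · intro h
    refine Prod.ext (funext fun i => ?_) (funext fun i => ?_)
    · simpa [labelled] using (h (e.symm i)).1.symm
    · simpa [labelled] using (h (e.symm i)).2.symm

theorem labelled_mono_iff {t : OTree} {n : ℕ} {e : t.Vertex ≃ Fin n} :
    (∀ i j, (t.labelled e).1 i = some j → j < i) ↔ t.Mono (Fin.val ∘ e) := by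
  constructor
  · intro h v u hv
    have := h (e v) (e u) (by simp [labelled, hv])
    exact this
  · intro h i j hij
    obtain ⟨u, hu, rfl⟩ := Option.map_eq_some_iff.1 hij
    simpa using h _ _ hu

/-- Two labelled plane trees with the same parents and colours are isomorphic. -/
theorem viso_of_labelled_eq {t₀ t : OTree} {n : ℕ} {e₀ : t₀.Vertex ≃ Fin n} {e : t.Vertex ≃ Fin n}
    (h : t.labelled e = t₀.labelled e₀) (v : t₀.Vertex) :
    t.parent ((e₀.trans e.symm) v) = (t₀.parent v).map (e₀.trans e.symm) ∧
      t.colour ((e₀.trans e.symm) v) = t₀.colour v := by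
  have h1 := labelled_eq_iff.1 h (e.symm (e₀ v))
  have h2 := labelled_eq_iff.1 (rfl : t₀.labelled e₀ = t₀.labelled e₀) v
  rw [e.apply_symm_apply] at h1
  refine ⟨?_, h1.2.symm.trans h2.2⟩
  have h3 := congrArg (Option.map e.symm) (h1.1.symm.trans h2.1)
  simpa [Option.map_map, Function.comp_def] using h3

/-- The plane trees with a labelling of prescribed parents and colours correspond to the
isomorphisms out of one of them. -/
def labelledEquiv {t₀ : OTree} {n : ℕ} (e₀ : t₀.Vertex ≃ Fin n) :
    (Σ t : OTree, {e : t.Vertex ≃ Fin n // t.labelled e = t₀.labelled e₀}) ≃ Σ u, VIso t₀ u :=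
  Equiv.sigmaCongrRight fun _ =>
    { toFun := fun e => ⟨e₀.trans e.1.symm, viso_of_labelled_eq e.2⟩
      invFun := fun φ => ⟨φ.1.symm.trans e₀, by
        rw [labelled_eq_iff]
        intro v
        obtain ⟨h1, h2⟩ := φ.symm.2 v
        change t₀.parent (φ.1.symm v) = _ at h1
        change t₀.colour (φ.1.symm v) = _ at h2
        simp [labelled, h1, h2, Option.map_map, Function.comp_def, VIso.symm]⟩
      left_inv := fun e => Subtype.ext (Equiv.ext fun v => by simp)
      right_inv := fun φ => Subtype.ext (Equiv.ext fun v => by simp) }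

end OTree

/-! ### `ω(ι)` as a sum over the plane representatives -/

namespace Tree

theorem finite_fiber (ι : Tree) : {t : OTree | Quotient.mk OTree.setoid t = ι}.Finite := by
  refine (OTree.finite_order_le ι.order).subset ?_
  rintro t rfl
  exact le_refl t.order

/-- Membership only provides some plane tree with the same parents and colours; any two such trees
are isomorphic, so the shape of `t` itself is forced. -/
theorem mem_monotoneLabelings_iff {ι : Tree} {t : OTree} {e : t.Vertex ≃ Fin ι.order} :
    t.labelled e ∈ ι.monotoneLabelings ↔
      Quotient.mk OTree.setoid t = ι ∧ t.Mono (Fin.val ∘ e) := by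
  constructor
  · rintro ⟨h1, t', ht', e', he'⟩
    refine ⟨?_, OTree.labelled_mono_iff.1 h1⟩
    rw [← ht']
    have h2 : t'.labelled e' = t.labelled e := OTree.labelled_eq_iff.2 he'
    exact Quotient.sound (OTree.VIso.iso ⟨_, OTree.viso_of_labelled_eq h2⟩)
  · rintro ⟨h1, h2⟩
    exact ⟨OTree.labelled_mono_iff.2 h2, t, h1, e, OTree.labelled_eq_iff.1 rfl⟩

/-- The coefficient `ω(ι)` is the sum of the weights of the plane trees of shape `ι`. -/
theorem sum_coeff_eq_omega (ι : Tree) :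
    ∑ t ∈ ι.finite_fiber.toFinset, t.coeff = ι.omega := by
  classical
  obtain ⟨t₀, ht₀⟩ := Quotient.exists_rep ι
  let n := ι.order
  -- The set that is counted twice. All plane trees of shape `ι` share the same density and the same
  -- `orderings`, so the sum of weights is the size of the fibre divided by one number.
  let Y := Σ t : OTree, {e : t.Vertex ≃ Fin n // t.labelled e ∈ ι.monotoneLabelings}
  have hord : ∀ t : OTree, Quotient.mk OTree.setoid t = ι → t.order = n := by
    rintro t rfl; rfl
  have hdens : ∀ t : OTree, Quotient.mk OTree.setoid t = ι → t.density = ι.density := by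
    rintro t rfl; rfl
  have horder : ∀ t : OTree, Quotient.mk OTree.setoid t = ι → t.orderings = t₀.orderings := by
    rintro t ht
    exact (Quotient.exact (ht.trans ht₀.symm) : OTree.Iso t t₀).orderings_eq
  have : Finite {t : OTree // Quotient.mk OTree.setoid t = ι} := ι.finite_fiber
  have : Fintype {t : OTree // Quotient.mk OTree.setoid t = ι} := Fintype.ofFinite _
  -- counting by the shape of the plane tree
  have hY1 : Nat.card Y * ι.density =
      Nat.card {t : OTree // Quotient.mk OTree.setoid t = ι} * Nat.factorial n := by
    let e1 : Y ≃ Σ t : {t : OTree // Quotient.mk OTree.setoid t = ι},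
        {e : t.1.Vertex ≃ Fin n // t.1.Mono (Fin.val ∘ e)} :=
      { toFun := fun x => ⟨⟨x.1, (mem_monotoneLabelings_iff.1 x.2.2).1⟩,
          ⟨x.2.1, (mem_monotoneLabelings_iff.1 x.2.2).2⟩⟩
        invFun := fun x => ⟨x.1.1, ⟨x.2.1, mem_monotoneLabelings_iff.2 ⟨x.1.2, x.2.2⟩⟩⟩
        left_inv := fun _ => rfl
        right_inv := fun _ => rfl }
    rw [Nat.card_congr e1, Nat.card_sigma, Finset.sum_mul]
    rw [Finset.sum_congr rfl (g := fun _ => Nat.factorial n), Finset.sum_const, smul_eq_mul,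
      Finset.card_univ, Nat.card_eq_fintype_card]
    rintro ⟨t, ht⟩ -
    have h := t.card_mono_mul_density (Fin n) Fin.val Fin.val_injective
      (by rw [Nat.card_eq_fintype_card, Fintype.card_fin, hord t ht])
    rwa [hdens t ht, hord t ht] at h
  -- counting by the parents and colours of the labels
  have hY2 : Nat.card Y = ι.numLabelings * t₀.orderings := by
    let e2 : Y ≃ Σ L : ι.monotoneLabelings,
        Σ t : OTree, {e : t.Vertex ≃ Fin n // t.labelled e = L.1} :=
      { toFun := fun x => ⟨⟨_, x.2.2⟩, ⟨x.1, ⟨x.2.1, rfl⟩⟩⟩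
        invFun := fun x => ⟨x.2.1, ⟨x.2.2.1, by rw [x.2.2.2]; exact x.1.2⟩⟩
        left_inv := fun _ => rfl
        right_inv := by
          rintro ⟨⟨L, hL⟩, t, e, (rfl : t.labelled e = L)⟩
          rfl }
    have hfib : ∀ L : ι.monotoneLabelings,
        Finite (Σ t : OTree, {e : t.Vertex ≃ Fin n // t.labelled e = L.1}) ∧
        Nat.card (Σ t : OTree, {e : t.Vertex ≃ Fin n // t.labelled e = L.1}) =
          t₀.orderings := by
      rintro ⟨L, hL⟩
      obtain ⟨-, t, ht, e, he⟩ := hL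
      have h := OTree.labelled_eq_iff.2 he
      change t.labelled e = L at h
      subst h
      have hc := OTree.VIso.card_sigma t
      have := hc.1
      refine ⟨Finite.of_equiv _ (OTree.labelledEquiv e).symm, ?_⟩
      rw [← horder t ht, ← hc.2]
      exact Nat.card_congr (OTree.labelledEquiv e)
    have := fun L => (hfib L).1
    have : Fintype ι.monotoneLabelings := Fintype.ofFinite _
    rw [Nat.card_congr e2, Nat.card_sigma, Finset.sum_congr rfl fun L _ => (hfib L).2,
      Finset.sum_const, smul_eq_mul, Finset.card_univ, ← Nat.card_eq_fintype_card]
    rfl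
  have hcard : ι.finite_fiber.toFinset.card =
      Nat.card {t : OTree // Quotient.mk OTree.setoid t = ι} := by
    exact (Nat.card_eq_card_finite_toFinset _).symm
  have hD : (t₀.orderings : ℝ) ≠ 0 := by exact_mod_cast t₀.orderings_pos.ne'
  rw [Finset.sum_congr rfl (g := fun _ => (t₀.orderings : ℝ)⁻¹), Finset.sum_const, nsmul_eq_mul,
    hcard, omega, eq_div_iff (by exact_mod_cast Nat.factorial_ne_zero _)]
  · rw [hY2] at hY1
    have h := congrArg (Nat.cast : ℕ → ℝ) hY1
    push_cast at h
    field_simp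
    rw [← h]; ring
  · intro t ht
    rw [OTree.coeff, horder t (by simpa using ht)]

end Tree
end SRK

/-! ### B-series over plane trees: grafting and size estimates -/

namespace SRK

namespace OTree

variable {E : Type*} [NormedAddCommGroup E] [NormedSpace ℝ E] {s : ℕ}

/-- The term of the plane tree `t` in the B-series of `g k (Y i)`, `k` the root colour of `t`. -/
noncomputable def bterm (g : Fin 2 → E → E) (Z : Fin 2 → Matrix (Fin s) (Fin s) ℝ) (y : E)
    (t : OTree) (i : Fin s) : E :=
  t.weight Z i • t.coeff • t.elemDiff g y

/-- The term of the plane tree `t` in the B-series of the stage `Y i`. -/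
noncomputable def sterm (g : Fin 2 → E → E) (Z : Fin 2 → Matrix (Fin s) (Fin s) ℝ) (y : E)
    (t : OTree) (i : Fin s) : E :=
  ∑ j, Z t.root i j • bterm g Z y t j

theorem sterm_eq (g : Fin 2 → E → E) (Z : Fin 2 → Matrix (Fin s) (Fin s) ℝ) (y : E)
    (t : OTree) (i : Fin s) :
    sterm g Z y t i = (Z t.root *ᵥ t.weight Z) i • t.coeff • t.elemDiff g y := by
  simp only [sterm, bterm, Matrix.mulVec, dotProduct, Finset.sum_smul]
  simp only [smul_smul, mul_assoc]

/-- The recursions for weight, coefficient and elementary differential combine by multilinearity: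
grafting branches on a new root is evaluating one Taylor term at the stage terms of the branches. -/
theorem bterm_node (g : Fin 2 → E → E) (Z : Fin 2 → Matrix (Fin s) (Fin s) ℝ) (y : E)
    (k : Fin 2) (l : ℕ) (c : Fin l → OTree) (i : Fin s) :
    bterm g Z y (node k l c) i = (Nat.factorial l : ℝ)⁻¹ •
      iteratedFDeriv ℝ l (g k) y fun j => sterm g Z y (c j) i := by
  simp only [sterm_eq, bterm, smul_smul, coeff_node, weight, elemDiff]
  rw [ContinuousMultilinearMap.map_smul_univ, Finset.prod_mul_distrib, smul_smul]
  congr 1; ring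

/-- The plane trees with at most `N` nodes. -/
noncomputable def upTo (N : ℕ) : Finset OTree := (finite_order_le N).toFinset

@[simp] theorem mem_upTo {N : ℕ} {t : OTree} : t ∈ upTo N ↔ t.order ≤ N := by
  simp [upTo]

theorem order_pos (t : OTree) : 0 < t.order := by
  cases t; simp [order]

open Classical in
/-- The plane trees whose root has colour `k` and at most `N` subtrees, each with at most `N`
nodes. -/
noncomputable def grafts (k : Fin 2) (N : ℕ) : Finset OTree :=
  ((Finset.range (N + 1)).sigma fun l => Fintype.piFinset fun _ : Fin l => upTo N).image
    fun x => node k x.1 x.2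

theorem sum_grafts {M : Type*} [AddCommMonoid M] (k : Fin 2) (N : ℕ) (F : OTree → M) :
    ∑ t ∈ grafts k N, F t = ∑ l ∈ Finset.range (N + 1),
      ∑ c ∈ Fintype.piFinset fun _ : Fin l => upTo N, F (node k l c) := by
  classical
  rw [grafts, Finset.sum_image, Finset.sum_sigma]
  rintro ⟨l, c⟩ - ⟨l', c'⟩ - h
  have h' : node k l c = node k l' c' := h
  obtain ⟨-, rfl, h2⟩ := OTree.node.inj h'
  rw [eq_of_heq h2]

theorem root_of_mem_grafts {k : Fin 2} {N : ℕ} {t : OTree} (h : t ∈ grafts k N) :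
    t.root = k := by
  simp only [grafts, Finset.mem_image] at h
  obtain ⟨x, -, rfl⟩ := h
  rfl

/-- `grafts` is a box in the arity and the branches, suited to multilinear expansion. It contains
every tree with at most `N + 1` nodes, one more than the branches are allowed, as the root is added.
-/
theorem mem_grafts_of_order_le {N : ℕ} {t : OTree} (h : t.order ≤ N + 1) :
    t ∈ grafts t.root N := by
  rcases t with ⟨k, l, c⟩
  simp only [order] at h
  have h1 : ∀ j, (c j).order ≤ N := fun j =>
    (Finset.single_le_sum (f := fun j => (c j).order) (fun _ _ => Nat.zero_le _)
      (Finset.mem_univ j)).trans (by omega)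
  have h2 : l ≤ N := by
    calc l = ∑ _j : Fin l, 1 := by simp
      _ ≤ ∑ j, (c j).order := Finset.sum_le_sum fun j _ => (c j).order_pos
      _ ≤ N := by omega
  simp only [grafts, Finset.mem_image, Finset.mem_sigma, Finset.mem_range, Fintype.mem_piFinset,
    mem_upTo]
  exact ⟨⟨l, c⟩, ⟨Nat.lt_succ_of_le h2, h1⟩, rfl⟩

/-- Expanding each derivative multilinearly at the truncated stage series reproduces the grafted
trees exactly. Both the smooth and the analytic argument rest on this identity. -/
theorem sum_grafts_bterm (g : Fin 2 → E → E) (Z : Fin 2 → Matrix (Fin s) (Fin s) ℝ) (y : E)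
    (k : Fin 2) (N : ℕ) (i : Fin s) :
    ∑ t ∈ grafts k N, bterm g Z y t i = ∑ l ∈ Finset.range (N + 1), (Nat.factorial l : ℝ)⁻¹ •
      iteratedFDeriv ℝ l (g k) y fun _ => ∑ t ∈ upTo N, sterm g Z y t i := by
  rw [sum_grafts]
  refine Finset.sum_congr rfl fun l _ => ?_
  rw [ContinuousMultilinearMap.map_sum_finset, Finset.smul_sum]
  exact Finset.sum_congr rfl fun c _ => bterm_node ..

theorem abs_mulVec_le {Z : Matrix (Fin s) (Fin s) ℝ} {v : Fin s → ℝ} {q b : ℝ} {i : Fin s}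
    (hZ : ∑ j, |Z i j| ≤ q) (hb : 0 ≤ b) (hv : ∀ j, |v j| ≤ b) : |(Z *ᵥ v) i| ≤ q * b := by
  calc |(Z *ᵥ v) i| = |∑ j, Z i j * v j| := rfl
    _ ≤ ∑ j, |Z i j * v j| := Finset.abs_sum_le_sum_abs _ _
    _ ≤ ∑ j, |Z i j| * b := Finset.sum_le_sum fun j _ => by
        rw [abs_mul]; exact mul_le_mul_of_nonneg_left (hv j) (abs_nonneg _)
    _ = (∑ j, |Z i j|) * b := by rw [Finset.sum_mul]
    _ ≤ q * b := mul_le_mul_of_nonneg_right hZ hb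

/-- Every node except the root contributes one stage matrix, whose absolute row sums are at most
`q`. -/
theorem abs_weight_le {Z : Fin 2 → Matrix (Fin s) (Fin s) ℝ} {q : ℝ} (hq : 0 ≤ q)
    (hZ : ∀ k i, ∑ j, |Z k i j| ≤ q) (t : OTree) :
    ∀ i, |t.weight Z i| ≤ q ^ (t.order - 1) := by
  induction t with
  | node k l c ih =>
    intro i
    simp only [weight, order, Nat.add_sub_cancel_left, Finset.abs_prod]
    rw [← Finset.prod_pow_eq_pow_sum]
    refine Finset.prod_le_prod (fun j _ => abs_nonneg _) fun j _ => ?_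
    refine (abs_mulVec_le (hZ _ _) (pow_nonneg hq _) (ih j)).trans (le_of_eq ?_)
    rw [← pow_succ', Nat.sub_add_cancel (c j).order_pos]

theorem norm_bterm_le (g : Fin 2 → E → E) {Z : Fin 2 → Matrix (Fin s) (Fin s) ℝ} {q : ℝ}
    (hq : 0 ≤ q) (hZ : ∀ k i, ∑ j, |Z k i j| ≤ q) (y : E) (t : OTree) (i : Fin s) :
    ‖bterm g Z y t i‖ ≤ q ^ (t.order - 1) * ‖t.coeff • t.elemDiff g y‖ := by
  rw [bterm, norm_smul]
  exact mul_le_mul_of_nonneg_right (abs_weight_le hq hZ t i) (norm_nonneg _)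

theorem norm_sterm_le (g : Fin 2 → E → E) {Z : Fin 2 → Matrix (Fin s) (Fin s) ℝ} {q : ℝ}
    (hq : 0 ≤ q) (hZ : ∀ k i, ∑ j, |Z k i j| ≤ q) (y : E) (t : OTree) (i : Fin s) :
    ‖sterm g Z y t i‖ ≤ q ^ t.order * ‖t.coeff • t.elemDiff g y‖ := by
  rw [sterm_eq, norm_smul]
  refine mul_le_mul_of_nonneg_right ?_ (norm_nonneg _)
  refine (abs_mulVec_le (hZ _ _) (pow_nonneg hq _) (abs_weight_le hq hZ t)).trans (le_of_eq ?_)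
  rw [← pow_succ', Nat.sub_add_cancel t.order_pos]

theorem norm_coeff_smul_elemDiff_node_le (g : Fin 2 → E → E) (y : E)
    (k : Fin 2) (l : ℕ) (c : Fin l → OTree) :
    ‖(node k l c).coeff • (node k l c).elemDiff g y‖ ≤
      (Nat.factorial l : ℝ)⁻¹ * ‖iteratedFDeriv ℝ l (g k) y‖ *
        ∏ j, ‖(c j).coeff • (c j).elemDiff g y‖ := by
  rw [norm_smul, Real.norm_of_nonneg (coeff_pos _).le, coeff_node, elemDiff]
  simp only [norm_smul, Finset.prod_mul_distrib, Real.norm_of_nonneg (coeff_pos _).le]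
  have h := (iteratedFDeriv ℝ l (g k) y).le_opNorm fun j => (c j).elemDiff g y
  have h0 : (0:ℝ) ≤ (Nat.factorial l : ℝ)⁻¹ * ∏ j, (c j).coeff :=
    mul_nonneg (by positivity) (Finset.prod_nonneg fun j _ => (coeff_pos _).le)
  refine (mul_le_mul_of_nonneg_left h h0).trans (le_of_eq (by ring))

end OTree

/-! ### Bounds on bounded sets -/

section Bounds

variable {E : Type*} [NormedAddCommGroup E] [NormedSpace ℝ E] [FiniteDimensional ℝ E]
  {g : Fin 2 → E → E}

theorem exists_bound_iteratedFDeriv (hg : ∀ k, ContDiff ℝ ∞ (g k)) (R : ℝ) (l : ℕ) :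
    ∃ C : ℝ, 0 ≤ C ∧ ∀ k y, ‖y‖ ≤ R → ‖iteratedFDeriv ℝ l (g k) y‖ ≤ C := by
  have : ProperSpace E := FiniteDimensional.proper_real E
  have h : ∀ k, ∃ C : ℝ, ∀ y ∈ Metric.closedBall (0 : E) R, ‖iteratedFDeriv ℝ l (g k) y‖ ≤ C :=
    fun k => (isCompact_closedBall 0 R).exists_bound_of_continuousOn
      ((hg k).continuous_iteratedFDeriv (by exact_mod_cast le_top)).continuousOn
  choose C hC using h
  refine ⟨max 0 (max (C 0) (C 1)), le_max_left _ _, fun k y hy => ?_⟩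
  have h1 := hC k y (by simpa using hy)
  fin_cases k
  · exact h1.trans ((le_max_left _ _).trans (le_max_right _ _))
  · exact h1.trans ((le_max_right _ _).trans (le_max_right _ _))

theorem exists_bound (hg : ∀ k, ContDiff ℝ ∞ (g k)) (R : ℝ) :
    ∃ C : ℝ, 0 ≤ C ∧ ∀ k y, ‖y‖ ≤ R → ‖g k y‖ ≤ C := by
  obtain ⟨C, hC, h⟩ := exists_bound_iteratedFDeriv hg R 0
  exact ⟨C, hC, fun k y hy => by simpa using h k y hy⟩

theorem exists_bound_elemDiff (hg : ∀ k, ContDiff ℝ ∞ (g k)) (R : ℝ) (t : OTree) :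
    ∃ C : ℝ, 0 ≤ C ∧ ∀ y, ‖y‖ ≤ R → ‖t.coeff • t.elemDiff g y‖ ≤ C := by
  induction t with
  | node k l c ih =>
    choose C hC0 hC using ih
    obtain ⟨D, hD0, hD⟩ := exists_bound_iteratedFDeriv hg R l
    refine ⟨(Nat.factorial l : ℝ)⁻¹ * D * ∏ j, C j,
      mul_nonneg (by positivity) (Finset.prod_nonneg fun j _ => hC0 j), fun y hy => ?_⟩
    refine (OTree.norm_coeff_smul_elemDiff_node_le g y k l c).trans ?_
    refine mul_le_mul (mul_le_mul_of_nonneg_left (hD k y hy) (by positivity)) ?_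
      (Finset.prod_nonneg fun j _ => norm_nonneg _) (by positivity)
    exact Finset.prod_le_prod (fun j _ => norm_nonneg _) fun j _ => hC j y hy

/-- Integral form of the remainder; the segment from `y` to `y + z` stays in the ball of radius `R +
r`, where the next derivative is bounded. -/
theorem exists_taylor_bound (hg : ∀ k, ContDiff ℝ ∞ (g k)) (R r : ℝ) (n : ℕ) :
    ∃ C : ℝ, 0 ≤ C ∧ ∀ k y z, ‖y‖ ≤ R → ‖z‖ ≤ r →
      ‖g k (y + z) - ∑ l ∈ Finset.range (n + 1), (Nat.factorial l : ℝ)⁻¹ •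
        iteratedFDeriv ℝ l (g k) y fun _ => z‖ ≤ C * ‖z‖ ^ (n + 1) := by
  obtain ⟨C, hC0, hC⟩ := exists_bound_iteratedFDeriv hg (R + r) (n + 1)
  refine ⟨C, hC0, fun k y z hy hz => ?_⟩
  rw [map_add_eq_sum_add_integral_iteratedFDeriv (n := n) fun t _ =>
    ((hg k).of_le (by exact_mod_cast le_top)).contDiffAt, add_sub_cancel_left, norm_smul]
  have h1 : ‖∫ t in (0:ℝ)..1, (1 - t) ^ n • iteratedFDeriv ℝ (n + 1) (g k) (y + t • z) fun _ => z‖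
      ≤ C * ‖z‖ ^ (n + 1) * |1 - 0| := by
    refine intervalIntegral.norm_integral_le_of_norm_le_const fun t ht => ?_
    rw [Set.uIoc_of_le zero_le_one] at ht
    rw [norm_smul]
    have h2 : ‖(1 - t) ^ n‖ ≤ 1 := by
      rw [norm_pow]
      refine pow_le_one₀ (norm_nonneg _) ?_
      rw [Real.norm_eq_abs, abs_le]
      constructor <;> linarith [ht.1, ht.2]
    have h3 : ‖y + t • z‖ ≤ R + r := by
      refine (norm_add_le _ _).trans (add_le_add hy ?_)
      rw [norm_smul, Real.norm_of_nonneg ht.1.le]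
      exact (mul_le_of_le_one_left (norm_nonneg _) ht.2).trans hz
    have h4 := (iteratedFDeriv ℝ (n + 1) (g k) (y + t • z)).le_opNorm fun _ => z
    rw [Finset.prod_const, Finset.card_univ, Fintype.card_fin] at h4
    have h5 := h4.trans (mul_le_mul_of_nonneg_right (hC k _ h3) (by positivity))
    calc _ ≤ 1 * (C * ‖z‖ ^ (n + 1)) :=
          mul_le_mul h2 h5 (norm_nonneg _) zero_le_one
      _ = _ := one_mul _
  have h6 : ‖(Nat.factorial n : ℝ)⁻¹‖ ≤ 1 := by
    rw [norm_inv, RCLike.norm_natCast]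
    exact inv_le_one_of_one_le₀ (by exact_mod_cast Nat.factorial_pos n)
  calc _ ≤ 1 * (C * ‖z‖ ^ (n + 1) * |1 - 0|) := mul_le_mul h6 h1 (norm_nonneg _) zero_le_one
    _ = _ := by norm_num

end Bounds

end SRK

/-! ### Expansion of smooth coefficients at the stages -/

namespace SRK

open OTree

/-- The B-series of the stages, truncated, is a combination of the truncated B-series of the
coefficients at the stages. -/
theorem sum_sterm {E : Type*} [NormedAddCommGroup E] [NormedSpace ℝ E] {s : ℕ}
    (g : Fin 2 → E → E) (Z : Fin 2 → Matrix (Fin s) (Fin s) ℝ) (y : E) (S : Finset OTree)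
    (i : Fin s) :
    ∑ t ∈ S, sterm g Z y t i =
      ∑ k, ∑ j, Z k i j • ∑ t ∈ S with t.root = k, bterm g Z y t j := by
  rw [← Finset.sum_fiberwise S OTree.root]
  refine Finset.sum_congr rfl fun k _ => ?_
  simp only [Finset.smul_sum]
  rw [Finset.sum_comm]
  refine Finset.sum_congr rfl fun t ht => ?_
  rw [sterm, (Finset.mem_filter.1 ht).2]

theorem norm_sum_smul_le {E : Type*} [NormedAddCommGroup E] [NormedSpace ℝ E] {s : ℕ}
    {Z : Fin 2 → Matrix (Fin s) (Fin s) ℝ} {q b : ℝ} (hb : 0 ≤ b) (i : Fin s)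
    (hZ : ∀ k, ∑ j, |Z k i j| ≤ q) {v : Fin 2 → Fin s → E} (hv : ∀ k j, ‖v k j‖ ≤ b) :
    ‖∑ k, ∑ j, Z k i j • v k j‖ ≤ 2 * q * b := by
  have h : ∀ k, ‖∑ j, Z k i j • v k j‖ ≤ q * b := fun k => by
    calc ‖∑ j, Z k i j • v k j‖ ≤ ∑ j, |Z k i j| * b := norm_sum_le_of_le _ fun j _ => by
          rw [norm_smul]; exact mul_le_mul_of_nonneg_left (hv k j) (abs_nonneg _)
      _ = (∑ j, |Z k i j|) * b := by rw [Finset.sum_mul]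
      _ ≤ q * b := mul_le_mul_of_nonneg_right (hZ k) hb
  calc ‖∑ k, ∑ j, Z k i j • v k j‖ ≤ ∑ _k : Fin 2, q * b := norm_sum_le_of_le _ fun k _ => h k
    _ = 2 * q * b := by simp; ring

/-- The B-series expansion, to order `N`, of smooth coefficients at the stages. -/
theorem exists_expansion_bound {E : Type*} [NormedAddCommGroup E] [NormedSpace ℝ E]
    [FiniteDimensional ℝ E] {s : ℕ} {g : Fin 2 → E → E} (hg : ∀ k, ContDiff ℝ ∞ (g k))
    (R r : ℝ) {b : ℝ} (hb : 0 ≤ b) (N : ℕ) :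
    ∃ K : ℝ, 0 ≤ K ∧ ∀ (y : E) (ε : ℝ) (Z : Fin 2 → Matrix (Fin s) (Fin s) ℝ) (Y : Fin s → E),
      ‖y‖ ≤ R → 0 ≤ ε → ε ≤ 1 → (∀ k i, ∑ j, |Z k i j| ≤ b * ε) → (∀ i, ‖Y i - y‖ ≤ r) →
      (∀ i, Y i = y + ∑ k, ∑ j, Z k i j • g k (Y j)) → ∀ k i,
        ‖g k (Y i) - ∑ t ∈ upTo N with t.root = k, bterm g Z y t i‖ ≤ K * ε ^ N := by
  obtain ⟨G, hG0, hG⟩ := exists_bound hg (R + r)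
  have hGY : ∀ {y : E} {Y : Fin s → E}, ‖y‖ ≤ R → (∀ i, ‖Y i - y‖ ≤ r) →
      ∀ k i, ‖g k (Y i)‖ ≤ G := by
    intro y Y hy hY k i
    refine hG k _ ?_
    calc ‖Y i‖ = ‖y + (Y i - y)‖ := by congr 1; abel
      _ ≤ R + r := (norm_add_le _ _).trans (add_le_add hy (hY i))
  induction N with
  | zero =>
    -- There are no trees without nodes, so at order zero the claim is mere boundedness.
    refine ⟨G, hG0, fun y ε Z Y hy hε hε1 hZ hr hY k i => ?_⟩
    have : (upTo 0).filter (fun t => t.root = k) = ∅ := by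
      refine Finset.filter_eq_empty_iff.2 fun t ht => ?_
      rw [mem_upTo] at ht
      exact absurd t.order_pos (by omega)
    rw [this]
    simpa using hGY hy hr k i
  | succ N ih =>
    obtain ⟨K, hK0, hK⟩ := ih
    obtain ⟨T, hT0, hT⟩ := exists_taylor_bound hg R r N
    choose C hC0 hC using exists_bound_iteratedFDeriv hg R
    choose F hF0 hF using exists_bound_elemDiff hg R
    -- Chosen so that `B * ε` bounds both the exact increment `D` and its truncated series `P`; the
    -- factor 2 is the number of colours.
    let B := 2 * b * (G + K)
    have hB0 : 0 ≤ B := by positivity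
    -- Three errors: `K1` is the Taylor remainder, `K2` the cost of replacing `D` by `P` in the
    -- Taylor polynomial, and `K3` collects the grafted trees with too many nodes.
    let K1 := T * B ^ (N + 1)
    let K2 := ∑ l ∈ Finset.range (N + 1), C l * l * B ^ (l - 1) * (2 * b * K)
    let K3 := ∑ k, ∑ t ∈ grafts k N, b ^ (t.order - 1) * F t
    refine ⟨K1 + K2 + K3, ?_, fun y ε Z Y hy hε hε1 hZ hr hY k i => ?_⟩
    · have h2 : 0 ≤ K2 := Finset.sum_nonneg fun l _ => by
        have := hC0 l
        positivity
      have h3 : 0 ≤ K3 := Finset.sum_nonneg fun k _ => Finset.sum_nonneg fun t _ => by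
        have := hF0 t
        positivity
      positivity
    have hq : 0 ≤ b * ε := mul_nonneg hb hε
    set P := ∑ t ∈ upTo N, sterm g Z y t i with hP
    set D := Y i - y with hD
    have hDsum : D = ∑ k, ∑ j, Z k i j • g k (Y j) := by
      rw [hD]; nth_rewrite 1 [hY i]; abel
    -- The gain of one order: the stage matrices multiply the error `ε ^ N` of the induction
    -- hypothesis by another factor `ε`.
    have hDP : ‖D - P‖ ≤ 2 * b * K * ε ^ (N + 1) := by
      rw [hDsum, hP, sum_sterm, ← Finset.sum_sub_distrib]
      simp only [← Finset.sum_sub_distrib, ← smul_sub]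
      refine (norm_sum_smul_le (by positivity) i (fun k => hZ k i)
        (hK y ε Z Y hy hε hε1 hZ hr hY)).trans (le_of_eq ?_)
      ring
    have hpow1 : ε ^ (N + 1) ≤ ε := by
      rw [pow_succ]; exact mul_le_of_le_one_left hε (pow_le_one₀ hε hε1)
    have hDn' : ‖D‖ ≤ 2 * b * G * ε := by
      rw [hDsum]
      refine (norm_sum_smul_le hG0 i (fun k => hZ k i) fun k j => hGY hy hr k j).trans
        (le_of_eq ?_)
      ring
    have hDn : ‖D‖ ≤ B * ε := by
      refine hDn'.trans ?_
      have : 0 ≤ 2 * b * K * ε := by positivity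
      simp only [B]; linarith
    have hPn : ‖P‖ ≤ B * ε := by
      calc ‖P‖ = ‖D - (D - P)‖ := by congr 1; abel
        _ ≤ ‖D‖ + ‖D - P‖ := norm_sub_le _ _
        _ ≤ 2 * b * G * ε + 2 * b * K * ε := add_le_add hDn'
            (hDP.trans (mul_le_mul_of_nonneg_left hpow1 (by positivity)))
        _ = B * ε := by simp only [B]; ring
    have hB1 : B * ε ≤ B := mul_le_of_le_one_right hB0 hε1
    have e1 : ‖g k (Y i) - ∑ l ∈ Finset.range (N + 1), (Nat.factorial l : ℝ)⁻¹ •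
        iteratedFDeriv ℝ l (g k) y fun _ => D‖ ≤ K1 * ε ^ (N + 1) := by
      have h := hT k y D hy (hr i)
      rw [show y + D = Y i by rw [hD]; abel] at h
      refine h.trans ?_
      rw [mul_assoc, ← mul_pow]
      gcongr
    have e2 : ‖(∑ l ∈ Finset.range (N + 1), (Nat.factorial l : ℝ)⁻¹ •
        iteratedFDeriv ℝ l (g k) y fun _ => D) - ∑ t ∈ grafts k N, bterm g Z y t i‖ ≤
        K2 * ε ^ (N + 1) := by
      rw [sum_grafts_bterm, ← Finset.sum_sub_distrib, Finset.sum_mul]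
      refine norm_sum_le_of_le _ fun l _ => ?_
      rw [← smul_sub, norm_smul]
      have h := (iteratedFDeriv ℝ l (g k) y).norm_image_sub_le (fun _ => D) fun _ => P
      have hfac : ‖(Nat.factorial l : ℝ)⁻¹‖ ≤ 1 := by
        rw [norm_inv, RCLike.norm_natCast]
        exact inv_le_one_of_one_le₀ (by exact_mod_cast Nat.factorial_pos l)
      have hn : ∀ v : E, ‖fun _ : Fin l => v‖ ≤ ‖v‖ := fun v =>
        (pi_norm_le_iff_of_nonneg (norm_nonneg _)).2 fun _ => le_rfl
      have hsub : ‖(fun _ : Fin l => D) - fun _ => P‖ ≤ 2 * b * K * ε ^ (N + 1) :=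
        (hn (D - P)).trans hDP
      have hmax : max ‖fun _ : Fin l => D‖ ‖fun _ : Fin l => P‖ ≤ B :=
        max_le ((hn D).trans (hDn.trans hB1)) ((hn P).trans (hPn.trans hB1))
      rw [Fintype.card_fin] at h
      have h2 : ‖iteratedFDeriv ℝ l (g k) y (fun _ => D) - iteratedFDeriv ℝ l (g k) y fun _ => P‖
          ≤ C l * l * B ^ (l - 1) * (2 * b * K * ε ^ (N + 1)) := by
        refine h.trans ?_
        have := hC0 l
        have := hC l k y hy
        gcongr
      calc _ ≤ 1 * (C l * l * B ^ (l - 1) * (2 * b * K * ε ^ (N + 1))) :=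
            mul_le_mul hfac h2 (norm_nonneg _) zero_le_one
        _ = _ := by ring
    have e3 : ‖∑ t ∈ grafts k N, bterm g Z y t i -
        ∑ t ∈ upTo (N + 1) with t.root = k, bterm g Z y t i‖ ≤ K3 * ε ^ (N + 1) := by
      classical
      have hsub : (upTo (N + 1)).filter (fun t => t.root = k) ⊆ grafts k N := by
        intro t ht
        rw [Finset.mem_filter, mem_upTo] at ht
        rw [← ht.2]
        exact mem_grafts_of_order_le ht.1
      rw [← Finset.sum_sdiff hsub, add_sub_cancel_right]
      have h1 : ‖∑ t ∈ grafts k N \ (upTo (N + 1)).filter (fun t => t.root = k),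
          bterm g Z y t i‖ ≤ ∑ t ∈ grafts k N \ (upTo (N + 1)).filter (fun t => t.root = k),
            b ^ (t.order - 1) * F t * ε ^ (N + 1) := by
        refine norm_sum_le_of_le _ fun t ht => ?_
        rw [Finset.mem_sdiff, Finset.mem_filter, mem_upTo] at ht
        -- A discarded graft has at least `N + 2` nodes; its root carries no matrix, which leaves
        -- the power `N + 1`.
        have hord : N + 1 ≤ t.order - 1 := by
          by_contra hlt
          exact ht.2 ⟨by omega, root_of_mem_grafts ht.1⟩
        refine (norm_bterm_le g hq hZ y t i).trans ?_
        rw [mul_pow]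
        have hεp : ε ^ (t.order - 1) ≤ ε ^ (N + 1) := pow_le_pow_of_le_one hε hε1 hord
        have := hF0 t
        calc _ ≤ b ^ (t.order - 1) * ε ^ (N + 1) * F t := by
              have := hF t y hy
              gcongr
          _ = _ := by ring
      refine h1.trans ?_
      rw [← Finset.sum_mul]
      refine mul_le_mul_of_nonneg_right ?_ (by positivity)
      have hnn : ∀ t : OTree, 0 ≤ b ^ (t.order - 1) * F t := fun t =>
        mul_nonneg (by positivity) (hF0 t)
      refine (Finset.sum_le_sum_of_subset_of_nonneg Finset.sdiff_subset fun t _ _ => hnn t).trans ?_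
      exact Finset.single_le_sum (f := fun k => ∑ t ∈ grafts k N, b ^ (t.order - 1) * F t)
        (fun k _ => Finset.sum_nonneg fun t _ => hnn t) (Finset.mem_univ k)
    calc _ ≤ _ := norm_sub_le_norm_sub_add_norm_sub _ (∑ t ∈ grafts k N, bterm g Z y t i) _
      _ ≤ (K1 * ε ^ (N + 1) + K2 * ε ^ (N + 1)) + K3 * ε ^ (N + 1) :=
          add_le_add ((norm_sub_le_norm_sub_add_norm_sub _ _ _).trans (add_le_add e1 e2)) e3
      _ = _ := by ring

end SRK

namespace SRK

open OTree

/-! ### Cauchy estimates for real-analytic functions -/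

/-- Cauchy estimates and a lower bound for the radius of convergence, uniform on `S`. -/
def CauchyBound {E F : Type*} [NormedAddCommGroup E] [NormedSpace ℝ E] [NormedAddCommGroup F]
    [NormedSpace ℝ F] (f : E → F) (S : Set E) (M a η : ℝ) : Prop :=
  ∀ y ∈ S, (∀ l : ℕ, ‖iteratedFDeriv ℝ l f y‖ ≤ Nat.factorial l * (M * a ^ l)) ∧
    ∃ p : FormalMultilinearSeries ℝ E F, HasFPowerSeriesOnBall f p y (ENNReal.ofReal η)

section Cauchy

variable {E F : Type*} [NormedAddCommGroup E] [NormedSpace ℝ E] [NormedAddCommGroup F]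
  [NormedSpace ℝ F] {f : E → F}

theorem CauchyBound.mono {S S' : Set E} {M M' a a' η η' : ℝ} (h : CauchyBound f S M a η)
    (hS : S' ⊆ S) (hM0 : 0 ≤ M) (ha0 : 0 ≤ a) (hη0 : 0 < η') (hM : M ≤ M') (ha : a ≤ a')
    (hη : η' ≤ η) : CauchyBound f S' M' a' η' := by
  intro y hy
  obtain ⟨h1, p, hp⟩ := h y (hS hy)
  refine ⟨fun l => (h1 l).trans ?_, p, hp.mono (ENNReal.ofReal_pos.2 hη0)
    (ENNReal.ofReal_le_ofReal hη)⟩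
  have := hM0.trans hM
  gcongr

theorem CauchyBound.union {S S' : Set E} {M a η : ℝ} (h : CauchyBound f S M a η)
    (h' : CauchyBound f S' M a η) : CauchyBound f (S ∪ S') M a η := by
  rintro y (hy | hy)
  · exact h y hy
  · exact h' y hy

/-- The derivative is the sum of the `l!` rearrangements of the coefficient `p l`, which need not be
symmetric. -/
theorem norm_iteratedFDeriv_le_of_hasFPowerSeriesOnBall [CompleteSpace F]
    {p : FormalMultilinearSeries ℝ E F} {y : E} {ρ : ENNReal}
    (h : HasFPowerSeriesOnBall f p y ρ) (l : ℕ) :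
    ‖iteratedFDeriv ℝ l f y‖ ≤ Nat.factorial l * ‖p l‖ := by
  refine ContinuousMultilinearMap.opNorm_le_bound (by positivity) fun v => ?_
  rw [h.iteratedFDeriv_eq_sum_of_completeSpace]
  calc ‖∑ σ : Equiv.Perm (Fin l), p l fun i => v (σ i)‖
      ≤ ∑ _σ : Equiv.Perm (Fin l), ‖p l‖ * ∏ i, ‖v i‖ := norm_sum_le_of_le _ fun σ _ => by
        refine ((p l).le_opNorm _).trans (le_of_eq ?_)
        rw [Equiv.prod_comp σ fun i => ‖v i‖]
    _ = Nat.factorial l * ‖p l‖ * ∏ i, ‖v i‖ := by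
        rw [Finset.sum_const, Finset.card_univ, Fintype.card_perm, Fintype.card_fin, nsmul_eq_mul,
          mul_assoc]

/-- Re-expand the power series at `x` around nearby points `y`. With `2 * r₀` below the radius of
convergence, the double series `S` of re-expanded coefficients converges and dominates all of them
uniformly in `y`; this gives `a = 1 / r₀` and leaves radius at least `r₀` around `y`. -/
theorem exists_cauchyBound_nhds [CompleteSpace F] {x : E} (h : AnalyticAt ℝ f x) :
    ∃ U ∈ nhds x, ∃ M a η : ℝ, 0 < M ∧ 0 < a ∧ 0 < η ∧ CauchyBound f U M a η := by
  obtain ⟨p, ρ, hp⟩ := h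
  obtain ⟨ρ', hρ'0, hρ'⟩ := ENNReal.lt_iff_exists_nnreal_btwn.1 hp.r_pos
  set r₀ : NNReal := ρ' / 2 with hr₀
  have hr₀pos : 0 < r₀ := by
    have : 0 < ρ' := by exact_mod_cast hρ'0
    positivity
  have hadd : (r₀ : ENNReal) + r₀ < ρ := by
    rw [← ENNReal.coe_add, hr₀, add_halves]; exact hρ'
  have hadd' : (r₀ : ENNReal) + r₀ < p.radius := hadd.trans_le hp.r_le
  have hlt : (r₀ : ENNReal) < p.radius := lt_of_le_of_lt le_self_add hadd'
  have hsum := p.changeOriginSeries_summable_aux₁ hadd'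
  set S := ∑' s : Σ k l : ℕ, { s : Finset (Fin (k + l)) // s.card = l },
    ‖p (s.1 + s.2.1)‖₊ * r₀ ^ s.2.1 * r₀ ^ s.1
  refine ⟨Metric.ball x r₀, Metric.ball_mem_nhds x (by exact_mod_cast hr₀pos), S + 1, (r₀ : ℝ)⁻¹,
    r₀, by positivity, by positivity, by exact_mod_cast hr₀pos, fun y hy => ?_⟩
  set z := y - x with hz
  have hzr : ‖z‖₊ ≤ r₀ := by
    rw [← NNReal.coe_le_coe, coe_nnnorm, hz, ← dist_eq_norm]
    exact (Metric.mem_ball.1 hy).le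
  have hzr' : (‖z‖₊ : ENNReal) ≤ r₀ := by exact_mod_cast hzr
  have hser := hp.changeOrigin (hzr'.trans_lt (lt_of_le_of_lt le_self_add hadd))
  rw [show x + z = y by rw [hz]; abel] at hser
  refine ⟨fun l => (norm_iteratedFDeriv_le_of_hasFPowerSeriesOnBall hser l).trans ?_,
    _, hser.mono (by simpa using hr₀pos) ?_⟩
  · have h1 : ‖p.changeOrigin z l‖₊ * r₀ ^ l ≤ S := by
      have h2 : ‖p.changeOrigin z l‖₊ ≤
          ∑' s : Σ l' : ℕ, { s : Finset (Fin (l + l')) // s.card = l' },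
            ‖p (l + s.1)‖₊ * r₀ ^ s.1 := by
        refine (p.nnnorm_changeOrigin_le l (hzr'.trans_lt hlt)).trans ?_
        refine Summable.tsum_le_tsum (fun s => ?_)
          (p.changeOriginSeries_summable_aux₂ (hzr'.trans_lt hlt) l)
          (p.changeOriginSeries_summable_aux₂ hlt l)
        gcongr
      calc _ ≤ (∑' s : Σ l' : ℕ, { s : Finset (Fin (l + l')) // s.card = l' },
            ‖p (l + s.1)‖₊ * r₀ ^ s.1) * r₀ ^ l := by gcongr
        _ = ∑' s : Σ l' : ℕ, { s : Finset (Fin (l + l')) // s.card = l' },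
            ‖p (l + s.1)‖₊ * r₀ ^ s.1 * r₀ ^ l := by rw [NNReal.tsum_mul_right]
        _ ≤ S := NNReal.tsum_comp_le_tsum_of_inj hsum
            (i := fun s : Σ l' : ℕ, { s : Finset (Fin (l + l')) // s.card = l' } =>
              (⟨l, s⟩ : Σ k l : ℕ, { s : Finset (Fin (k + l)) // s.card = l }))
            fun s s' h => eq_of_heq (Sigma.mk.inj h).2
    have h3 : ‖p.changeOrigin z l‖ * (r₀ : ℝ) ^ l ≤ S := by exact_mod_cast h1
    have hr : (0 : ℝ) < r₀ := by exact_mod_cast hr₀pos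
    refine mul_le_mul_of_nonneg_left ?_ (by positivity)
    rw [inv_pow, ← div_eq_mul_inv, le_div_iff₀ (by positivity)]
    linarith
  · rw [ENNReal.ofReal_coe_nnreal]
    refine le_trans ?_ (tsub_le_tsub_left hzr' ρ)
    exact ENNReal.le_sub_of_add_le_right ENNReal.coe_ne_top hadd.le

/-- Compactness: local constants are merged by taking maxima of `M`, `a` and minima of `η`. -/
theorem exists_cauchyBound [CompleteSpace F] {S : Set E} (hS : IsCompact S)
    (h : ∀ x ∈ S, AnalyticAt ℝ f x) :
    ∃ M a η : ℝ, 0 < M ∧ 0 < a ∧ 0 < η ∧ CauchyBound f S M a η := by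
  refine hS.induction_on
    (p := fun S => ∃ M a η : ℝ, 0 < M ∧ 0 < a ∧ 0 < η ∧ CauchyBound f S M a η) ?_ ?_ ?_ ?_
  · exact ⟨1, 1, 1, one_pos, one_pos, one_pos, fun y hy => hy.elim⟩
  · rintro s t hst ⟨M, a, η, hM, ha, hη, hb⟩
    exact ⟨M, a, η, hM, ha, hη, fun y hy => hb y (hst hy)⟩
  · rintro s t ⟨M, a, η, hM, ha, hη, hb⟩ ⟨M', a', η', hM', ha', hη', hb'⟩
    have hmin := lt_min hη hη'
    refine ⟨max M M', max a a', min η η', lt_max_of_lt_left hM, lt_max_of_lt_left ha, hmin, ?_⟩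
    exact (hb.mono subset_rfl hM.le ha.le hmin (le_max_left _ _) (le_max_left _ _)
      (min_le_left _ _)).union (hb'.mono subset_rfl hM'.le ha'.le hmin (le_max_right _ _)
      (le_max_right _ _) (min_le_right _ _))
  · intro x hx
    obtain ⟨U, hU, hb⟩ := exists_cauchyBound_nhds (h x hx)
    exact ⟨U, mem_nhdsWithin_of_mem_nhds hU, hb⟩

theorem exists_cauchyBound_pair [CompleteSpace F] {g : Fin 2 → E → F} {S : Set E}
    (hS : IsCompact S) (h : ∀ k, ∀ x ∈ S, AnalyticAt ℝ (g k) x) :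
    ∃ M a η : ℝ, 0 < M ∧ 0 < a ∧ 0 < η ∧ ∀ k, CauchyBound (g k) S M a η := by
  obtain ⟨M, a, η, hM, ha, hη, hb⟩ := exists_cauchyBound hS (h 0)
  obtain ⟨M', a', η', hM', ha', hη', hb'⟩ := exists_cauchyBound hS (h 1)
  have hmin := lt_min hη hη'
  refine ⟨max M M', max a a', min η η', lt_max_of_lt_left hM, lt_max_of_lt_left ha, hmin, ?_⟩
  intro k
  fin_cases k
  · exact hb.mono subset_rfl hM.le ha.le hmin (le_max_left _ _) (le_max_left _ _) (min_le_left _ _)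
  · exact hb'.mono subset_rfl hM'.le ha'.le hmin (le_max_right _ _) (le_max_right _ _)
      (min_le_right _ _)

end Cauchy

/-! ### The generating function of plane trees -/

theorem sum_grafts_pow {Q : ℝ} (k : Fin 2) (N : ℕ) :
    ∑ t ∈ grafts k N, Q ^ t.order =
      ∑ l ∈ Finset.range (N + 1), Q * (∑ t ∈ upTo N, Q ^ t.order) ^ l := by
  rw [sum_grafts]
  refine Finset.sum_congr rfl fun l _ => ?_
  have h : (∑ t ∈ upTo N, Q ^ t.order) ^ l = ∏ _j : Fin l, ∑ t ∈ upTo N, Q ^ t.order := by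
    rw [Finset.prod_const, Finset.card_univ, Fintype.card_fin]
  rw [h, Finset.prod_univ_sum, Finset.mul_sum]
  refine Finset.sum_congr rfl fun c _ => ?_
  rw [order, pow_add, pow_one, Finset.prod_pow_eq_pow_sum]

/-- The generating function formally satisfies `T = 2 * Q / (1 - T)`. If the truncation is at most
`4 * Q ≤ 1 / 2`, the geometric series is at most 2, so each of the two colours contributes at most
`2 * Q` and the bound reproduces itself. -/
theorem sum_upTo_pow_le {Q : ℝ} (hQ : 0 ≤ Q) (hQ8 : Q ≤ 1 / 8) (N : ℕ) :
    ∑ t ∈ upTo N, Q ^ t.order ≤ 4 * Q := by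
  induction N with
  | zero =>
    have : upTo 0 = ∅ := Finset.eq_empty_of_forall_notMem fun t ht => by
      rw [mem_upTo] at ht
      exact absurd t.order_pos (by omega)
    rw [this]; simpa using hQ
  | succ N ih =>
    have hS0 : 0 ≤ ∑ t ∈ upTo N, Q ^ t.order := Finset.sum_nonneg fun t _ => by positivity
    have hg : ∀ k, ∑ t ∈ grafts k N, Q ^ t.order ≤ 2 * Q := fun k => by
      rw [sum_grafts_pow, ← Finset.mul_sum, mul_comm 2]
      refine mul_le_mul_of_nonneg_left ?_ hQ
      calc ∑ l ∈ Finset.range (N + 1), (∑ t ∈ upTo N, Q ^ t.order) ^ l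
          ≤ ∑ l ∈ Finset.range (N + 1), (1 / 2 : ℝ) ^ l :=
            Finset.sum_le_sum fun l _ => pow_le_pow_left₀ hS0 (by linarith) l
        _ ≤ ∑' l : ℕ, (1 / 2 : ℝ) ^ l :=
            summable_geometric_two.sum_le_tsum _ fun l _ => by positivity
        _ = 2 := tsum_geometric_two
    rw [← Finset.sum_fiberwise (upTo (N + 1)) OTree.root]
    calc _ ≤ ∑ k : Fin 2, ∑ t ∈ grafts k N, Q ^ t.order := by
          refine Finset.sum_le_sum fun k _ => Finset.sum_le_sum_of_subset_of_nonneg ?_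
            fun t _ _ => by positivity
          intro t ht
          rw [Finset.mem_filter, mem_upTo] at ht
          rw [← ht.2]
          exact mem_grafts_of_order_le ht.1
      _ ≤ ∑ _k : Fin 2, 2 * Q := Finset.sum_le_sum fun k _ => hg k
      _ = 4 * Q := by simp; ring

theorem subset_upTo (u : Finset OTree) {N : ℕ} (hN : u.sup OTree.order ≤ N) : u ⊆ upTo N :=
  fun _ ht => mem_upTo.2 ((Finset.le_sup (f := OTree.order) ht).trans hN)

theorem sum_pow_order_le {Q : ℝ} (hQ : 0 ≤ Q) (hQ8 : Q ≤ 1 / 8) (u : Finset OTree) :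
    ∑ t ∈ u, Q ^ t.order ≤ 4 * Q :=
  (Finset.sum_le_sum_of_subset_of_nonneg (subset_upTo u le_rfl) fun t _ _ => by positivity).trans
    (sum_upTo_pow_le hQ hQ8 _)

theorem summable_pow_order {Q : ℝ} (hQ : 0 ≤ Q) (hQ8 : Q ≤ 1 / 8) :
    Summable fun t : OTree => Q ^ t.order :=
  summable_of_sum_le (fun _ => by positivity) (sum_pow_order_le hQ hQ8)

theorem tsum_pow_order_le {Q : ℝ} (hQ : 0 ≤ Q) (hQ8 : Q ≤ 1 / 8) :
    ∑' t : OTree, Q ^ t.order ≤ 4 * Q :=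
  (summable_pow_order hQ hQ8).tsum_le_of_sum_le (sum_pow_order_le hQ hQ8)

theorem tendsto_upTo : Filter.Tendsto upTo Filter.atTop Filter.atTop :=
  Filter.tendsto_atTop.2 fun u => by
    filter_upwards [Filter.eventually_ge_atTop (u.sup OTree.order)] with N hN
    exact subset_upTo u hN

/-! ### Convergence of the B-series -/

section Convergence

variable {E : Type*} [NormedAddCommGroup E] [NormedSpace ℝ E] {s : ℕ} {g : Fin 2 → E → E}
  {Z : Fin 2 → Matrix (Fin s) (Fin s) ℝ} {y : E} {M a η q : ℝ}

/-- The factor `l!` of the Cauchy estimate cancels the weight `1 / l!` of the root, and its `a ^ l`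
gives one factor `a` to each branch. With the extra `a` on the left the estimate is multiplicative
over the tree. -/
theorem norm_coeff_smul_elemDiff_le (hM : 0 < M) (ha : 0 < a)
    (hb : ∀ k, CauchyBound (g k) {y} M a η) (t : OTree) :
    ‖t.coeff • t.elemDiff g y‖ * a ≤ (M * a) ^ t.order := by
  induction t with
  | node k l c ih =>
    have h1 := ((hb k) y rfl).1 l
    have h2 := norm_coeff_smul_elemDiff_node_le g y k l c
    have hfac : (0:ℝ) < Nat.factorial l := by exact_mod_cast Nat.factorial_pos l
    calc _ ≤ ((Nat.factorial l : ℝ)⁻¹ * ‖iteratedFDeriv ℝ l (g k) y‖ *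
          ∏ j, ‖(c j).coeff • (c j).elemDiff g y‖) * a := by gcongr
      _ ≤ ((Nat.factorial l : ℝ)⁻¹ * (Nat.factorial l * (M * a ^ l)) *
          ∏ j, ‖(c j).coeff • (c j).elemDiff g y‖) * a := by
          have : 0 ≤ ∏ j, ‖(c j).coeff • (c j).elemDiff g y‖ :=
            Finset.prod_nonneg fun j _ => norm_nonneg _
          gcongr
      _ = M * a * ∏ j, (‖(c j).coeff • (c j).elemDiff g y‖ * a) := by
          rw [Finset.prod_mul_distrib, Finset.prod_const, Finset.card_univ, Fintype.card_fin]
          field_simp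
      _ ≤ M * a * ∏ j, (M * a) ^ (c j).order := by
          have := Finset.prod_le_prod (s := Finset.univ)
            (fun j _ => mul_nonneg (norm_nonneg ((c j).coeff • (c j).elemDiff g y)) ha.le)
            fun j _ => ih j
          gcongr
      _ = _ := by rw [order, pow_add, pow_one, Finset.prod_pow_eq_pow_sum]

theorem norm_sterm_le_pow (hM : 0 < M) (ha : 0 < a) (hq : 0 < q)
    (hb : ∀ k, CauchyBound (g k) {y} M a η) (hZ : ∀ k i, ∑ j, |Z k i j| ≤ q) (t : OTree)
    (i : Fin s) : ‖sterm g Z y t i‖ ≤ a⁻¹ * (M * a * q) ^ t.order := by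
  refine (norm_sterm_le g hq.le hZ y t i).trans ?_
  rw [mul_pow, inv_mul_eq_div, le_div_iff₀ ha, mul_assoc, mul_comm]
  exact mul_le_mul_of_nonneg_right (norm_coeff_smul_elemDiff_le hM ha hb t) (by positivity)

theorem norm_bterm_le_pow (hM : 0 < M) (ha : 0 < a) (hq : 0 < q)
    (hb : ∀ k, CauchyBound (g k) {y} M a η) (hZ : ∀ k i, ∑ j, |Z k i j| ≤ q) (t : OTree)
    (i : Fin s) : ‖bterm g Z y t i‖ ≤ (a * q)⁻¹ * (M * a * q) ^ t.order := by
  refine (norm_bterm_le g hq.le hZ y t i).trans ?_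
  rw [mul_pow, inv_mul_eq_div, le_div_iff₀ (by positivity)]
  calc _ = ‖t.coeff • t.elemDiff g y‖ * a * (q ^ (t.order - 1) * q) := by ring
    _ ≤ (M * a) ^ t.order * (q ^ (t.order - 1) * q) :=
      mul_le_mul_of_nonneg_right (norm_coeff_smul_elemDiff_le hM ha hb t) (by positivity)
    _ = _ := by rw [← pow_succ, Nat.sub_add_cancel t.order_pos]

theorem summable_norm_bterm (hM : 0 < M) (ha : 0 < a) (hq : 0 < q)
    (hb : ∀ k, CauchyBound (g k) {y} M a η) (hZ : ∀ k i, ∑ j, |Z k i j| ≤ q)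
    (hQ : M * a * q ≤ 1 / 8) (i : Fin s) : Summable fun t => ‖bterm g Z y t i‖ :=
  ((summable_pow_order (by positivity) hQ).mul_left _).of_nonneg_of_le (fun _ => norm_nonneg _)
    fun t => norm_bterm_le_pow hM ha hq hb hZ t i

/-- For coefficients satisfying Cauchy estimates the B-series of the stages converges, and its sum
solves the stage equations. -/
theorem exists_hasSum_bterm [CompleteSpace E] (hM : 0 < M) (ha : 0 < a) (hq : 0 < q)
    (hb : ∀ k, CauchyBound (g k) {y} M a η) (hZ : ∀ k i, ∑ j, |Z k i j| ≤ q)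
    (hQ : M * a * q ≤ 1 / 8) (hη : 4 * M * q < η) :
    ∃ D : Fin s → E, (∀ i, ‖D i‖ ≤ 4 * M * q) ∧
      (∀ i, D i = ∑ k, ∑ j, Z k i j • g k (y + D j)) ∧
      ∀ k i, HasSum (fun t : OTree => if t.root = k then bterm g Z y t i else 0)
        (g k (y + D i)) := by
  have hQ0 : 0 ≤ M * a * q := by positivity
  have hsummS : ∀ i, Summable fun t => ‖sterm g Z y t i‖ := fun i =>
    ((summable_pow_order hQ0 hQ).mul_left _).of_nonneg_of_le (fun _ => norm_nonneg _)
      fun t => norm_sterm_le_pow hM ha hq hb hZ t i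
  let D : Fin s → E := fun i => ∑' t, sterm g Z y t i
  have hD : ∀ i, ‖D i‖ ≤ 4 * M * q := fun i => by
    have h1 : ‖D i‖ ≤ a⁻¹ * ∑' t : OTree, (M * a * q) ^ t.order :=
      tsum_of_norm_bounded ((summable_pow_order hQ0 hQ).hasSum.mul_left a⁻¹)
        fun t => norm_sterm_le_pow hM ha hq hb hZ t i
    refine h1.trans ((mul_le_mul_of_nonneg_left (tsum_pow_order_le hQ0 hQ)
      (by positivity)).trans (le_of_eq ?_))
    field_simp
  have hlimD : ∀ i, Filter.Tendsto (fun N => ∑ t ∈ upTo N, sterm g Z y t i) Filter.atTop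
      (nhds (D i)) := fun i => (hsummS i).of_norm.hasSum.comp tendsto_upTo
  have hfilt : ∀ k i, Summable fun t : OTree => if t.root = k then bterm g Z y t i else 0 := by
    intro k i
    refine Summable.of_norm_bounded (summable_norm_bterm hM ha hq hb hZ hQ i) fun t => ?_
    split_ifs
    · exact le_rfl
    · simp
  have hbsum : ∀ k i, HasSum (fun t : OTree => if t.root = k then bterm g Z y t i else 0)
      (g k (y + D i)) := by
    intro k i
    classical
    -- The grafts of a single colour do not exhaust all plane trees; their union over both colours
    -- does.
    have h1 : Filter.Tendsto (fun N => Finset.univ.biUnion fun k => grafts k N) Filter.atTop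
        Filter.atTop := Filter.tendsto_atTop.2 fun u => by
      filter_upwards [Filter.eventually_ge_atTop (u.sup OTree.order)] with N hN
      intro t ht
      refine Finset.mem_biUnion.2 ⟨t.root, Finset.mem_univ _, mem_grafts_of_order_le ?_⟩
      have := Finset.le_sup (f := OTree.order) ht
      omega
    have h2 := (hfilt k i).hasSum.comp h1
    have h3 : ∀ N, ∑ t ∈ Finset.univ.biUnion fun k => grafts k N,
        (if t.root = k then bterm g Z y t i else 0) = ∑ t ∈ grafts k N, bterm g Z y t i := by
      intro N
      rw [← Finset.sum_filter]
      refine Finset.sum_congr (Finset.ext fun t => ?_) fun _ _ => rfl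
      simp only [Finset.mem_filter, Finset.mem_biUnion, Finset.mem_univ, true_and]
      constructor
      · rintro ⟨⟨k', h⟩, rfl⟩
        rwa [root_of_mem_grafts h]
      · exact fun h => ⟨⟨k, h⟩, root_of_mem_grafts h⟩
    obtain ⟨-, p, hp⟩ := hb k y rfl
    -- The sum over grafts is a partial sum of the power series of `g k` at `y`, evaluated at the
    -- truncated stage series.
    have h4 : ∀ N, ∑ t ∈ grafts k N, bterm g Z y t i =
        p.partialSum (N + 1) (∑ t ∈ upTo N, sterm g Z y t i) := by
      intro N
      rw [sum_grafts_bterm, FormalMultilinearSeries.partialSum]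
      refine Finset.sum_congr rfl fun l _ => ?_
      rw [← hp.factorial_smul, ← Nat.cast_smul_eq_nsmul ℝ, smul_smul,
        inv_mul_cancel₀ (by exact_mod_cast (Nat.factorial_pos l).ne'), one_smul]
    have hmem : D i ∈ Metric.eball (0 : E) (ENNReal.ofReal η) := by
      rw [Metric.mem_eball, edist_zero_right, ← ofReal_norm]
      exact (ENNReal.ofReal_lt_ofReal_iff_of_nonneg (norm_nonneg _)).2 ((hD i).trans_lt hη)
    have hcont : ContinuousWithinAt (fun z => g k (y + z)) (Metric.eball (0 : E)
        (ENNReal.ofReal η)) (D i) := by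
      have h5 := hp.continuousOn
      refine ContinuousWithinAt.comp (t := Metric.eball y (ENNReal.ofReal η))
        (h5 _ ?_) (continuous_const.add continuous_id).continuousWithinAt ?_
      · simpa [edist_eq_enorm_sub] using hmem
      · intro z hz
        simpa [edist_eq_enorm_sub] using hz
    -- Degree and argument of the partial sums vary together, so local uniform convergence is
    -- needed. The shift `N - 1` pairs `partialSum (N + 1)` with `upTo N` after the reindexing that
    -- follows.
    have h5 := hp.tendstoLocallyUniformlyOn.tendsto_comp (p := Filter.atTop)
      (g := fun N => ∑ t ∈ upTo (N - 1), sterm g Z y t i) hcont hmem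
      (tendsto_nhdsWithin_of_tendsto_nhds_of_eventually_within _
        ((hlimD i).comp (Filter.tendsto_sub_atTop_nat 1))
        ((((hlimD i).comp (Filter.tendsto_sub_atTop_nat 1)).eventually
          (Metric.isOpen_eball.mem_nhds hmem))))
    have h6 := h5.comp (Filter.tendsto_add_atTop_nat 1)
    have h7 : Filter.Tendsto (fun N => ∑ t ∈ grafts k N, bterm g Z y t i) Filter.atTop
        (nhds (g k (y + D i))) := by
      refine h6.congr fun N => ?_
      rw [h4]
      rfl
    have h8 := tendsto_nhds_unique h7 (h2.congr h3)
    rw [h8]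
    exact (hfilt k i).hasSum
  refine ⟨D, hD, fun i => ?_, hbsum⟩
  -- The stage equation holds between truncations by `sum_sterm`; pass to the limit on both sides.
  refine tendsto_nhds_unique (hlimD i) ?_
  simp only [sum_sterm]
  refine tendsto_finsetSum _ fun k _ => tendsto_finsetSum _ fun j _ => ?_
  refine Filter.Tendsto.const_smul ?_ _
  simp only [Finset.sum_filter]
  exact (hbsum k j).comp tendsto_upTo

end Convergence

end SRK

namespace SRK

open OTree

/-! ### The stage equations -/

section Stages

variable {E : Type*} [NormedAddCommGroup E] [NormedSpace ℝ E] {s : ℕ} {g : Fin 2 → E → E}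

theorem exists_lipschitz [FiniteDimensional ℝ E] (hg : ∀ k, ContDiff ℝ ∞ (g k)) (R : ℝ) :
    ∃ L : ℝ, 0 ≤ L ∧ ∀ k x y, ‖x‖ ≤ R → ‖y‖ ≤ R → ‖g k x - g k y‖ ≤ L * ‖x - y‖ := by
  obtain ⟨L, hL0, hL⟩ := exists_bound_iteratedFDeriv hg R 1
  refine ⟨L, hL0, fun k x y hx hy => ?_⟩
  refine (convex_closedBall (0 : E) R).norm_image_sub_le_of_norm_fderiv_le (𝕜 := ℝ)
    (fun z _ => ((hg k).differentiable (by simp)).differentiableAt) (fun z hz => ?_)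
    (by simpa using hy) (by simpa using hx)
  rw [← norm_iteratedFDeriv_one]
  exact hL k z (by simpa using hz)

/-- Unique solvability of the stage equations for small stage matrices. -/
theorem exists_unique_stages [FiniteDimensional ℝ E] (hg : ∀ k, ContDiff ℝ ∞ (g k)) (R : ℝ)
    {r : ℝ} (hr : 0 < r) :
    ∃ q : ℝ, 0 < q ∧ ∀ (y : E) (Z : Fin 2 → Matrix (Fin s) (Fin s) ℝ), ‖y‖ ≤ R →
      (∀ k i, ∑ j, |Z k i j| ≤ q) →
      ∃! Y : Fin s → E, (∀ i, ‖Y i - y‖ ≤ r) ∧ ∀ i, Y i = y + ∑ k, ∑ j, Z k i j • g k (Y j) := by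
  have : CompleteSpace E := FiniteDimensional.complete ℝ E
  obtain ⟨G, hG0, hG⟩ := exists_bound hg (R + r)
  obtain ⟨L, hL0, hL⟩ := exists_lipschitz hg (R + r)
  -- The first bound makes the iteration map the `r`-ball into itself, the second gives contraction
  -- factor `1 / 2`; adding 1 to `G` and `L` keeps the denominators positive.
  refine ⟨min (r / (2 * (G + 1))) (1 / (4 * (L + 1))), by positivity, fun y Z hy hZ => ?_⟩
  set q := min (r / (2 * (G + 1))) (1 / (4 * (L + 1))) with hq
  have hq0 : 0 < q := by positivity
  have hqG : 2 * q * G ≤ r := by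
    have h1 : q ≤ r / (2 * (G + 1)) := min_le_left _ _
    rw [le_div_iff₀ (by positivity)] at h1
    nlinarith
  have hqL : 2 * q * L ≤ 1 / 2 := by
    have h1 : q ≤ 1 / (4 * (L + 1)) := min_le_right _ _
    rw [le_div_iff₀ (by positivity)] at h1
    nlinarith
  let T : (Fin s → E) → Fin s → E := fun Y i => y + ∑ k, ∑ j, Z k i j • g k (Y j)
  let S : Set (Fin s → E) := {Y | ∀ i, ‖Y i - y‖ ≤ r}
  have hball : ∀ Y ∈ S, ∀ i, ‖Y i‖ ≤ R + r := fun Y hY i => by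
    calc ‖Y i‖ = ‖y + (Y i - y)‖ := by congr 1; abel
      _ ≤ R + r := (norm_add_le _ _).trans (add_le_add hy (hY i))
  have hmaps : Set.MapsTo T S S := fun Y hY i => by
    simp only [T, add_sub_cancel_left]
    exact (norm_sum_smul_le hG0 i (fun k => hZ k i) fun k j => hG k _ (hball Y hY j)).trans hqG
  have hcontr : ∀ Y ∈ S, ∀ Y' ∈ S, ‖T Y - T Y'‖ ≤ 1 / 2 * ‖Y - Y'‖ := fun Y hY Y' hY' => by
    refine (pi_norm_le_iff_of_nonneg (by positivity)).2 fun i => ?_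
    have h1 : (T Y - T Y') i = ∑ k, ∑ j, Z k i j • (g k (Y j) - g k (Y' j)) := by
      simp only [T, Pi.sub_apply, add_sub_add_left_eq_sub, ← Finset.sum_sub_distrib, smul_sub]
    rw [h1]
    refine (norm_sum_smul_le (b := L * ‖Y - Y'‖) (by positivity) i (fun k => hZ k i)
      fun k j => ?_).trans ?_
    · exact (hL k _ _ (hball Y hY j) (hball Y' hY' j)).trans
        (mul_le_mul_of_nonneg_left (norm_le_pi_norm (Y - Y') j) hL0)
    · rw [← mul_assoc]
      exact mul_le_mul_of_nonneg_right hqL (norm_nonneg _)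
  have hclosed : IsClosed S := by
    simp only [S, Set.ofPred_forall]
    exact isClosed_iInter fun i => isClosed_le (by fun_prop) continuous_const
  have hlip : ContractingWith (1 / 2) (hmaps.restrict T S S) := by
    refine ⟨by rw [← NNReal.coe_lt_coe]; norm_num, LipschitzWith.of_dist_le_mul ?_⟩
    rintro ⟨Y, hY⟩ ⟨Y', hY'⟩
    rw [Subtype.dist_eq, Subtype.dist_eq, dist_eq_norm, dist_eq_norm]
    simpa using hcontr Y hY Y' hY'
  have hy0 : (fun _ => y) ∈ S := fun i => by simpa using hr.le
  obtain ⟨Y, hY, hfix, -⟩ := hlip.exists_fixedPoint' hclosed.isComplete hmaps hy0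
    (edist_ne_top _ _)
  refine ⟨Y, ⟨hY, fun i => (congrFun hfix i).symm⟩, ?_⟩
  rintro Y' ⟨hY', hfix'⟩
  have h1 := hcontr Y' hY' Y hY
  rw [show T Y' = Y' from funext fun i => (hfix' i).symm, show T Y = Y from hfix] at h1
  have h2 : ‖Y' - Y‖ = 0 := le_antisymm (by linarith [norm_nonneg (Y' - Y)]) (norm_nonneg _)
  exact sub_eq_zero.1 (norm_eq_zero.1 h2)

/-- For real-analytic coefficients the B-series converge at solutions of the stage equations. -/
theorem exists_hasSum_stages [FiniteDimensional ℝ E] (hg : ∀ k, ContDiff ℝ ∞ (g k))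
    (han : ∀ k, AnalyticOnNhd ℝ (g k) Set.univ) (R : ℝ) {r : ℝ} (hr : 0 < r) :
    ∃ q : ℝ, 0 < q ∧ ∀ (y : E) (Z : Fin 2 → Matrix (Fin s) (Fin s) ℝ) (Y : Fin s → E), ‖y‖ ≤ R →
      (∀ k i, ∑ j, |Z k i j| ≤ q) → (∀ i, ‖Y i - y‖ ≤ r) →
      (∀ i, Y i = y + ∑ k, ∑ j, Z k i j • g k (Y j)) →
      ∀ k i, HasSum (fun t : OTree => if t.root = k then bterm g Z y t i else 0) (g k (Y i)) := by
  have : CompleteSpace E := FiniteDimensional.complete ℝ E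
  have : ProperSpace E := FiniteDimensional.proper_real E
  obtain ⟨q₀, hq₀, huniq⟩ := exists_unique_stages (s := s) hg R hr
  obtain ⟨M, a, η, hM, ha, hη, hb⟩ := exists_cauchyBound_pair (isCompact_closedBall (0 : E) R)
    fun k x _ => han k x (Set.mem_univ x)
  -- The four bounds secure uniqueness of the stages, `M * a * q ≤ 1 / 8` for the generating
  -- function, `4 * M * q < η` for the radius of convergence, and a series solution within distance
  -- `r` of `y`.
  refine ⟨min q₀ (min (1 / (8 * (M * a))) (min (η / (8 * M)) (r / (4 * M)))), by positivity,
    fun y Z Y hy hZ hYr hY k i => ?_⟩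
  set q := min q₀ (min (1 / (8 * (M * a))) (min (η / (8 * M)) (r / (4 * M))))
  have hq : 0 < q := by positivity
  have h0 : q ≤ q₀ := min_le_left _ _
  have h1 : q ≤ 1 / (8 * (M * a)) := (min_le_right _ _).trans (min_le_left _ _)
  have h2 : q ≤ η / (8 * M) :=
    (min_le_right _ _).trans ((min_le_right _ _).trans (min_le_left _ _))
  have h3 : q ≤ r / (4 * M) :=
    (min_le_right _ _).trans ((min_le_right _ _).trans (min_le_right _ _))
  rw [le_div_iff₀ (by positivity)] at h1 h2 h3
  obtain ⟨D, hD, hDeq, hsum⟩ := exists_hasSum_bterm (g := g) (Z := Z) (y := y) (η := η) hM ha hq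
    (fun k x hx => hb k x (by rw [Set.mem_singleton_iff.1 hx]; simpa using hy)) hZ
    (by linarith) (by nlinarith)
  -- Uniqueness in the `r`-ball identifies the given stages with the sum of the series.
  have hYD : Y = fun i => y + D i := by
    refine (huniq y Z hy fun k i => (hZ k i).trans h0).unique ⟨hYr, hY⟩ ⟨fun i => ?_, fun i => ?_⟩
    · rw [add_sub_cancel_left]
      exact (hD i).trans (by linarith)
    · exact congrArg (y + ·) (hDeq i)
  rw [hYD]
  exact hsum k i

end Stages

/-! ### From plane trees to isomorphism classes -/

section Classes

variable {E : Type*} [NormedAddCommGroup E] [NormedSpace ℝ E] {s : ℕ} {g : Fin 2 → E → E}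

/-- The term `ω(ι) Φ_i(ι) F(ι)(y)` of the tree `ι`. -/
noncomputable def tterm (g : Fin 2 → E → E) (Z : Fin 2 → Matrix (Fin s) (Fin s) ℝ) (y : E)
    (ι : Tree) (i : Fin s) : E :=
  (ι.omega * ι.weight Z i) • ι.elemDiff g y

/-- The vector `Φ` and the elementary differential are constant on an isomorphism class, while the
plane weights add up to `ω(ι)`. -/
theorem sum_fiber_bterm (hg : ∀ k, ContDiff ℝ ∞ (g k)) (Z : Fin 2 → Matrix (Fin s) (Fin s) ℝ)
    (y : E) (ι : Tree) (i : Fin s) :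
    ∑ t ∈ ι.finite_fiber.toFinset, bterm g Z y t i = tterm g Z y ι i := by
  rw [tterm, ← ι.sum_coeff_eq_omega, Finset.sum_mul, Finset.sum_smul]
  refine Finset.sum_congr rfl fun t ht => ?_
  obtain rfl : Quotient.mk OTree.setoid t = ι := by simpa using ht
  rw [Tree.elemDiff_mk hg, bterm, smul_smul, mul_comm]
  rfl

/-- The isomorphism class of a plane tree. -/
def OTree.shape (t : OTree) : Tree := Quotient.mk OTree.setoid t

theorem mem_fiber_iff {ι : Tree} {t : OTree} : t ∈ ι.finite_fiber.toFinset ↔ t.shape = ι := by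
  rw [Set.Finite.mem_toFinset]
  rfl

theorem finite_treesUpTo (k : Fin 2) (N : ℕ) : {ι : Γ k | ι.1.order ≤ N}.Finite :=
  (Tree.finite_order_le N).preimage Subtype.val_injective.injOn

/-- The trees with root colour `k` and at most `N` nodes. -/
noncomputable def treesUpTo (k : Fin 2) (N : ℕ) : Finset (Γ k) := (finite_treesUpTo k N).toFinset

theorem mem_treesUpTo {k : Fin 2} {N : ℕ} {ι : Γ k} : ι ∈ treesUpTo k N ↔ ι.1.order ≤ N := by
  simp [treesUpTo]

theorem sum_treesUpTo_tterm (hg : ∀ k, ContDiff ℝ ∞ (g k))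
    (Z : Fin 2 → Matrix (Fin s) (Fin s) ℝ) (y : E) (k : Fin 2) (N : ℕ) (i : Fin s) :
    ∑ ι ∈ treesUpTo k N, tterm g Z y ι.1 i = ∑ t ∈ upTo N with t.root = k, bterm g Z y t i := by
  classical
  have h : ∀ t ∈ (upTo N).filter (fun t => t.root = k),
      t.shape ∈ (treesUpTo k N).image Subtype.val := by
    intro t ht
    rw [Finset.mem_filter, mem_upTo] at ht
    exact Finset.mem_image.2 ⟨⟨t.shape, ht.2⟩, mem_treesUpTo.2 ht.1, rfl⟩
  have h' := Finset.sum_fiberwise_of_maps_to (g := OTree.shape) (by convert h)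
    fun t => bterm g Z y t i
  rw [← h', Finset.sum_image Subtype.val_injective.injOn]
  refine Finset.sum_congr rfl fun ι hι => ?_
  rw [← sum_fiber_bterm hg]
  refine Finset.sum_congr (Finset.ext fun t => ?_) fun _ _ => rfl
  rw [mem_fiber_iff, Finset.mem_filter, Finset.mem_filter, mem_upTo]
  constructor
  · intro h
    have h1 := mem_treesUpTo.1 hι
    have h2 : ι.1.root = k := ι.2
    rw [← h] at h1 h2
    exact ⟨⟨h1, h2⟩, h⟩
  · exact fun h => h.2

/-- An unconditional sum may be regrouped along the finite fibres of `shape`. -/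
theorem hasSum_tterm [CompleteSpace E] (hg : ∀ k, ContDiff ℝ ∞ (g k))
    {Z : Fin 2 → Matrix (Fin s) (Fin s) ℝ}
    {y : E} {k : Fin 2} {i : Fin s} {v : E}
    (h : HasSum (fun t : OTree => if t.root = k then bterm g Z y t i else 0) v) :
    HasSum (fun ι : Γ k => tterm g Z y ι.1 i) v := by
  classical
  have h1 := (Equiv.sigmaFiberEquiv OTree.shape).hasSum_iff.2 h
  have h2 : HasSum (fun ι : Tree => if ι.root = k then tterm g Z y ι i else 0) v := by
    refine h1.sigma fun ι => ?_
    have : Fintype {t : OTree // t.shape = ι} := ι.finite_fiber.fintype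
    have h3 : (if ι.root = k then tterm g Z y ι i else 0) =
        ∑ t : {t : OTree // t.shape = ι},
          if t.1.root = k then bterm g Z y t.1 i else 0 := by
      have h4 : ∀ t : {t : OTree // t.shape = ι}, t.1.root = ι.root := by
        rintro ⟨t, rfl⟩; rfl
      simp only [h4]
      split_ifs
      · rw [← sum_fiber_bterm hg]
        exact Finset.sum_subtype _ (fun t => mem_fiber_iff) _
      · simp
    rw [h3]
    exact hasSum_fintype _
  refine (hasSum_subtype_iff_indicator (f := fun ι => tterm g Z y ι i) (s := Γ k)).2 ?_
  have h3 : (Γ k).indicator (fun ι => tterm g Z y ι i) =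
      fun ι => if ι.root = k then tterm g Z y ι i else 0 := by
    funext ι
    by_cases hι : ι.root = k
    · rw [if_pos hι, Set.indicator_of_mem (show ι ∈ Γ k from hι)]
    · rw [if_neg hι, Set.indicator_of_notMem (show ι ∉ Γ k from hι)]
  rwa [h3]

theorem exists_bound_tterm [FiniteDimensional ℝ E] (hg : ∀ k, ContDiff ℝ ∞ (g k)) (R : ℝ)
    (ι : Tree) :
    ∃ C : ℝ, 0 ≤ C ∧ ∀ (y : E) (Z : Fin 2 → Matrix (Fin s) (Fin s) ℝ) (q : ℝ), ‖y‖ ≤ R → 0 ≤ q →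
      (∀ k i, ∑ j, |Z k i j| ≤ q) → ∀ i, ‖tterm g Z y ι i‖ ≤ C * q ^ (ι.order - 1) := by
  choose F hF0 hF using exists_bound_elemDiff hg R
  refine ⟨∑ t ∈ ι.finite_fiber.toFinset, F t, Finset.sum_nonneg fun t _ => hF0 t,
    fun y Z q hy hq hZ i => ?_⟩
  rw [← sum_fiber_bterm hg, Finset.sum_mul]
  refine norm_sum_le_of_le _ fun t ht => ?_
  obtain rfl : Quotient.mk OTree.setoid t = ι := by simpa using ht
  refine (norm_bterm_le g hq hZ y t i).trans ?_
  rw [mul_comm]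
  exact mul_le_mul_of_nonneg_right (hF t y hy) (by positivity)

end Classes

end SRK

namespace SRK

open OTree

/-! ### The quadratic invariant -/

section Quadratic

variable {d : ℕ} (C : Matrix (Fin d) (Fin d) ℝ)

theorem bilin_eq_sum (x y : EuclideanSpace ℝ (Fin d)) :
    bilin C x y = ∑ a, ∑ b, C a b * (x a * y b) := by
  simp only [bilin, dotProduct, Matrix.mulVec, Finset.mul_sum]
  exact Finset.sum_congr rfl fun a _ => Finset.sum_congr rfl fun b _ => by ring

/-- `bilin C` as a bilinear map. -/
def bilinMap : EuclideanSpace ℝ (Fin d) →ₗ[ℝ] EuclideanSpace ℝ (Fin d) →ₗ[ℝ] ℝ :=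
  LinearMap.mk₂ ℝ (bilin C) (fun x y z => by simp [bilin, add_dotProduct])
    (fun c x y => by simp [bilin, smul_dotProduct])
    (fun x y z => by simp [bilin, Matrix.mulVec_add, dotProduct_add])
    (fun c x y => by simp [bilin, Matrix.mulVec_smul, dotProduct_smul])

theorem bilinMap_apply (x y : EuclideanSpace ℝ (Fin d)) : bilinMap C x y = bilin C x y := rfl

theorem bilin_comm (hC : C.IsSymm) (x y : EuclideanSpace ℝ (Fin d)) :
    bilin C x y = bilin C y x := by
  rw [bilin_eq_sum, bilin_eq_sum, Finset.sum_comm]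
  refine Finset.sum_congr rfl fun a _ => Finset.sum_congr rfl fun b _ => ?_
  rw [hC.apply a b]; ring

theorem abs_bilin_le (x y : EuclideanSpace ℝ (Fin d)) :
    |bilin C x y| ≤ (∑ a, ∑ b, |C a b|) * (‖x‖ * ‖y‖) := by
  rw [bilin_eq_sum, Finset.sum_mul]
  refine (Finset.abs_sum_le_sum_abs _ _).trans (Finset.sum_le_sum fun a _ => ?_)
  rw [Finset.sum_mul]
  refine (Finset.abs_sum_le_sum_abs _ _).trans (Finset.sum_le_sum fun b _ => ?_)
  rw [abs_mul, abs_mul]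
  have h1 := PiLp.norm_apply_le x a
  have h2 := PiLp.norm_apply_le y b
  rw [Real.norm_eq_abs] at h1 h2
  gcongr

variable {C}

/-- By symmetry of `C`, the derivative of `yᵀ C y` in direction `v` is `2 yᵀ C v`. -/
theorem bilin_eq_zero_of_gradient {v : EuclideanSpace ℝ (Fin d)} {y : EuclideanSpace ℝ (Fin d)}
    (hC : C.IsSymm) (hd : DifferentiableAt ℝ (quad C) y)
    (h : inner ℝ (gradient (quad C) y) v = 0) : bilin C y v = 0 := by
  have h1 : fderiv ℝ (quad C) y v = 0 := by
    rw [← h, gradient, InnerProductSpace.toDual_symm_apply]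
  have h2 : HasDerivAt (fun t : ℝ => quad C (y + t • v)) (fderiv ℝ (quad C) y v) 0 := by
    have h3 : HasDerivAt (fun t : ℝ => y + t • v) v 0 := by
      simpa using ((hasDerivAt_id (0:ℝ)).smul_const v).const_add y
    have hd' : HasFDerivAt (quad C) (fderiv ℝ (quad C) y) (y + (0:ℝ) • v) := by
      simpa using hd.hasFDerivAt
    exact hd'.comp_hasDerivAt (0:ℝ) h3
  have h4 : (fun t : ℝ => quad C (y + t • v)) =
      fun t : ℝ => quad C y + t * (2 * bilin C y v) + t ^ 2 * quad C v := by
    funext t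
    simp only [quad, ← bilinMap_apply, map_add, map_smul, LinearMap.add_apply,
      LinearMap.smul_apply, smul_eq_mul]
    simp only [bilinMap_apply, bilin_comm C hC v y]
    ring
  have h5 : HasDerivAt (fun t : ℝ => quad C (y + t • v)) (2 * bilin C y v) 0 := by
    rw [h4]
    have h6 := (((hasDerivAt_id (0:ℝ)).mul_const (2 * bilin C y v)).const_add (quad C y)).add
      (((hasDerivAt_id (0:ℝ)).pow 2).mul_const (quad C v))
    exact (h6 : HasDerivAt (fun t : ℝ => quad C y + t * (2 * bilin C y v) + t ^ 2 * quad C v) _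
      0).congr_deriv (by simp)
  have h7 := h5.unique h2
  rw [h1] at h7
  linarith

/-- `∑ᵢⱼ M_{ij} u_iᵀ C v_j`. -/
def pairing {s : ℕ} (C : Matrix (Fin d) (Fin d) ℝ) (M : Matrix (Fin s) (Fin s) ℝ)
    (u v : Fin s → EuclideanSpace ℝ (Fin d)) : ℝ :=
  ∑ i, ∑ j, M i j * bilin C (u i) (v j)

variable {s : ℕ}

theorem bilin_sum_left {ι : Type*} (S : Finset ι) (u : ι → EuclideanSpace ℝ (Fin d))
    (y : EuclideanSpace ℝ (Fin d)) : bilin C (∑ i ∈ S, u i) y = ∑ i ∈ S, bilin C (u i) y := by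
  simp only [← bilinMap_apply, map_sum, LinearMap.sum_apply]

theorem bilin_sum_right {ι : Type*} (S : Finset ι) (u : ι → EuclideanSpace ℝ (Fin d))
    (y : EuclideanSpace ℝ (Fin d)) : bilin C y (∑ i ∈ S, u i) = ∑ i ∈ S, bilin C y (u i) := by
  simp only [← bilinMap_apply, map_sum]

theorem bilin_smul_left (c : ℝ) (x y : EuclideanSpace ℝ (Fin d)) :
    bilin C (c • x) y = c * bilin C x y := by
  simp only [← bilinMap_apply, map_smul, LinearMap.smul_apply, smul_eq_mul]

theorem bilin_smul_right (c : ℝ) (x y : EuclideanSpace ℝ (Fin d)) :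
    bilin C x (c • y) = c * bilin C x y := by
  simp only [← bilinMap_apply, map_smul, smul_eq_mul]

theorem bilin_add_left (x x' y : EuclideanSpace ℝ (Fin d)) :
    bilin C (x + x') y = bilin C x y + bilin C x' y := by
  simp only [← bilinMap_apply, map_add, LinearMap.add_apply]

theorem bilin_add_right (x y y' : EuclideanSpace ℝ (Fin d)) :
    bilin C x (y + y') = bilin C x y + bilin C x y' := by
  simp only [← bilinMap_apply, map_add]

theorem pairing_sum {ι κ : Type*} (M : Matrix (Fin s) (Fin s) ℝ) (S : Finset ι) (T : Finset κ)
    (u : ι → Fin s → EuclideanSpace ℝ (Fin d)) (v : κ → Fin s → EuclideanSpace ℝ (Fin d)) :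
    pairing C M (fun i => ∑ a ∈ S, u a i) (fun j => ∑ b ∈ T, v b j) =
      ∑ p ∈ S ×ˢ T, pairing C M (u p.1) (v p.2) := by
  have h : ∀ i j, bilin C (∑ a ∈ S, u a i) (∑ b ∈ T, v b j) =
      ∑ p ∈ S ×ˢ T, bilin C (u p.1 i) (v p.2 j) := fun i j => by
    rw [bilin_sum_left, Finset.sum_product]
    exact Finset.sum_congr rfl fun a _ => bilin_sum_right ..
  simp only [pairing, h]
  rw [Finset.sum_comm]
  refine Eq.trans ?_ Finset.sum_comm
  rw [Finset.sum_comm]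
  refine Finset.sum_congr rfl fun i _ => ?_
  rw [Finset.sum_comm]
  exact Finset.sum_congr rfl fun j _ => Finset.mul_sum ..

theorem abs_pairing_le (C : Matrix (Fin d) (Fin d) ℝ) (M : Matrix (Fin s) (Fin s) ℝ)
    {u v : Fin s → EuclideanSpace ℝ (Fin d)} {a b : ℝ} (ha : 0 ≤ a)
    (hu : ∀ i, ‖u i‖ ≤ a) (hv : ∀ i, ‖v i‖ ≤ b) :
    |pairing C M u v| ≤ (∑ i, ∑ j, |M i j|) * (∑ i, ∑ j, |C i j|) * (a * b) := by
  rw [pairing, mul_assoc, Finset.sum_mul]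
  refine (Finset.abs_sum_le_sum_abs _ _).trans (Finset.sum_le_sum fun i _ => ?_)
  rw [Finset.sum_mul]
  refine (Finset.abs_sum_le_sum_abs _ _).trans (Finset.sum_le_sum fun j _ => ?_)
  rw [abs_mul]
  refine mul_le_mul_of_nonneg_left ((abs_bilin_le C _ _).trans ?_) (abs_nonneg _)
  refine mul_le_mul_of_nonneg_left (mul_le_mul (hu i) (hv j) (norm_nonneg _) ha) ?_
  positivity

theorem pairing_sub (M : Matrix (Fin s) (Fin s) ℝ) (u u' v v' : Fin s → EuclideanSpace ℝ (Fin d)) :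
    pairing C M u v - pairing C M u' v' =
      pairing C M (u - u') v + pairing C M u' (v - v') := by
  simp only [pairing, ← Finset.sum_sub_distrib, ← Finset.sum_add_distrib]
  refine Finset.sum_congr rfl fun i _ => Finset.sum_congr rfl fun j _ => ?_
  simp only [← bilinMap_apply, Pi.sub_apply, map_sub, LinearMap.sub_apply]
  ring

theorem hasSum_coord {ι : Type*} {u : ι → EuclideanSpace ℝ (Fin d)}
    {U : EuclideanSpace ℝ (Fin d)} (hu : HasSum u U) (a : Fin d) :
    HasSum (fun x => u x a) (U a) := by
  have h := (EuclideanSpace.proj (𝕜 := ℝ) a : EuclideanSpace ℝ (Fin d) →L[ℝ] ℝ).hasSum hu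
  exact h

/-- Summable real families converge absolutely, so products of series may be summed over pairs; the
vector version follows coordinatewise. -/
theorem hasSum_mul_real {ι κ : Type*} {f : ι → ℝ} {g : κ → ℝ} {a b : ℝ} (hf : HasSum f a)
    (hg : HasSum g b) : HasSum (fun p : ι × κ => f p.1 * g p.2) (a * b) :=
  hf.mul hg (summable_mul_of_summable_norm hf.summable.norm hg.summable.norm)

theorem hasSum_bilin {ι κ : Type*} {u : ι → EuclideanSpace ℝ (Fin d)}
    {v : κ → EuclideanSpace ℝ (Fin d)} {U V : EuclideanSpace ℝ (Fin d)} (hu : HasSum u U)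
    (hv : HasSum v V) : HasSum (fun p : ι × κ => bilin C (u p.1) (v p.2)) (bilin C U V) := by
  have h : ∀ a b, HasSum (fun p : ι × κ => u p.1 a * v p.2 b) (U a * V b) := fun a b =>
    hasSum_mul_real (hasSum_coord hu a) (hasSum_coord hv b)
  have h2 : HasSum (fun p : ι × κ => ∑ a, ∑ b, C a b * (u p.1 a * v p.2 b))
      (∑ a, ∑ b, C a b * (U a * V b)) :=
    hasSum_sum fun a _ => hasSum_sum fun b _ => (h a b).mul_left _
  rw [bilin_eq_sum]
  exact h2.congr_fun fun p => bilin_eq_sum ..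

theorem hasSum_pairing {ι κ : Type*} (M : Matrix (Fin s) (Fin s) ℝ)
    {u : ι → Fin s → EuclideanSpace ℝ (Fin d)} {v : κ → Fin s → EuclideanSpace ℝ (Fin d)}
    {U V : Fin s → EuclideanSpace ℝ (Fin d)} (hu : ∀ i, HasSum (fun a => u a i) (U i))
    (hv : ∀ i, HasSum (fun a => v a i) (V i)) :
    HasSum (fun p : ι × κ => pairing C M (u p.1) (v p.2)) (pairing C M U V) :=
  hasSum_sum fun i _ => hasSum_sum fun j _ => (hasSum_bilin (hu i) (hv j)).mul_left _

/-- The defect of the quadratic invariant in one step of the method. -/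
theorem quad_step_sub {f g : EuclideanSpace ℝ (Fin d) → EuclideanSpace ℝ (Fin d)}
    (hC : IsQuadraticInvariant f g C) {A B : Matrix (Fin s) (Fin s) ℝ} {α β : Fin s → ℝ}
    {h w : ℝ} {y y' : EuclideanSpace ℝ (Fin d)} {Y : Fin s → EuclideanSpace ℝ (Fin d)}
    (hY : StageEq f g A B h w y Y)
    (hy' : y' = y + h • ∑ i, α i • f (Y i) + w • ∑ i, β i • g (Y i)) :
    quad C y' - quad C y =
      - (h * h * pairing C (MDiag A α) (fun i => f (Y i)) fun i => f (Y i))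
      - 2 * (h * w * pairing C (MStar A B α β) (fun i => f (Y i)) fun i => g (Y i))
      - w * w * pairing C (MDiag B β) (fun i => g (Y i)) fun i => g (Y i) := by
  obtain ⟨hs, hd, hI⟩ := hC
  have hf0 : ∀ x, bilin C x (f x) = 0 := fun x => bilin_eq_zero_of_gradient hs (hd x) (hI x).1
  have hg0 : ∀ x, bilin C x (g x) = 0 := fun x => bilin_eq_zero_of_gradient hs (hd x) (hI x).2
  have hexp : ∀ i v, bilin C (Y i) v = bilin C y v + h * ∑ j, A i j * bilin C (f (Y j)) v +
      w * ∑ j, B i j * bilin C (g (Y j)) v := by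
    intro i v
    rw [hY i]
    simp only [bilin_add_left, bilin_smul_left, bilin_sum_left]
  -- Pairing the stage equation with `f (Y i)` and using orthogonality at `Y i` expresses the
  -- product with `y` through products of stage values.
  have hyf : ∀ i, bilin C y (f (Y i)) = - (h * ∑ j, A i j * bilin C (f (Y j)) (f (Y i))) -
      w * ∑ j, B i j * bilin C (g (Y j)) (f (Y i)) := fun i => by
    have := hexp i (f (Y i)); rw [hf0] at this; linarith
  have hyg : ∀ i, bilin C y (g (Y i)) = - (h * ∑ j, A i j * bilin C (f (Y j)) (g (Y i))) -
      w * ∑ j, B i j * bilin C (g (Y j)) (g (Y i)) := fun i => by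
    have := hexp i (g (Y i)); rw [hg0] at this; linarith
  have hq : quad C y' - quad C y = 2 * h * ∑ i, α i * bilin C y (f (Y i)) +
      2 * w * ∑ i, β i * bilin C y (g (Y i)) +
      h * h * ∑ i, ∑ j, α i * α j * bilin C (f (Y i)) (f (Y j)) +
      2 * (h * w) * ∑ i, ∑ j, α i * β j * bilin C (f (Y i)) (g (Y j)) +
      w * w * ∑ i, ∑ j, β i * β j * bilin C (g (Y i)) (g (Y j)) := by
    have hsum : ∀ (a b : Fin s → ℝ) (u v : Fin s → EuclideanSpace ℝ (Fin d)),
        bilin C (∑ i, a i • u i) (∑ j, b j • v j) =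
          ∑ i, ∑ j, a i * b j * bilin C (u i) (v j) := by
      intro a b u v
      rw [bilin_sum_left]
      refine Finset.sum_congr rfl fun i _ => ?_
      rw [bilin_sum_right]
      refine Finset.sum_congr rfl fun j _ => ?_
      rw [bilin_smul_left, bilin_smul_right, mul_assoc]
    have hsum1 : ∀ (a : Fin s → ℝ) (u : Fin s → EuclideanSpace ℝ (Fin d)),
        bilin C y (∑ i, a i • u i) = ∑ i, a i * bilin C y (u i) := by
      intro a u
      simp only [bilin_sum_right, bilin_smul_right]
    rw [← hsum, ← hsum, ← hsum, ← hsum1, ← hsum1, hy']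
    set p := ∑ i, α i • f (Y i)
    set q := ∑ i, β i • g (Y i)
    simp only [quad, bilin_add_left, bilin_add_right, bilin_smul_left, bilin_smul_right]
    rw [bilin_comm C hs p y, bilin_comm C hs q y, bilin_comm C hs q p]
    ring
  -- One identity for all three matrices: `M⁰`, `M*` and `M¹` arise from `(A, A)`, `(A, B)` and `(B,
  -- B)`. The term with `A'ᵀ` is transposed by exchanging the summations.
  have hpair : ∀ (A' B' : Matrix (Fin s) (Fin s) ℝ) (a b : Fin s → ℝ)
      (u v : Fin s → EuclideanSpace ℝ (Fin d)),
      pairing C (Matrix.diagonal a * B' + A'ᵀ * Matrix.diagonal b - Matrix.vecMulVec a b) u v =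
      ∑ i, ∑ j, a i * B' i j * bilin C (v j) (u i) + ∑ i, ∑ j, b i * A' i j * bilin C (u j) (v i) -
        ∑ i, ∑ j, a i * b j * bilin C (u i) (v j) := by
    intro A' B' a b u v
    rw [Finset.sum_comm (f := fun i j => b i * A' i j * bilin C (u j) (v i))]
    simp only [pairing, ← Finset.sum_add_distrib, ← Finset.sum_sub_distrib]
    refine Finset.sum_congr rfl fun i _ => Finset.sum_congr rfl fun j _ => ?_
    rw [bilin_comm C hs (v j) (u i)]
    simp only [Matrix.sub_apply, Matrix.add_apply, Matrix.diagonal_mul, Matrix.mul_diagonal,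
      Matrix.transpose_apply, Matrix.vecMulVec_apply]
    ring
  rw [hq, MDiag, MStar, MDiag, hpair, hpair, hpair]
  simp only [hyf, hyg, mul_sub, mul_neg, Finset.sum_sub_distrib, Finset.sum_neg_distrib,
    mul_left_comm _ h, mul_left_comm _ w, ← Finset.mul_sum]
  simp only [Finset.mul_sum, mul_assoc]
  simp only [← Finset.mul_sum]
  ring

end Quadratic

end SRK

namespace SRK

open OTree

/-! ### The expansion of the defect -/

section Expansion

variable {d s : ℕ}

/-- Isolates the prefactors, so that each double series is the pairing of two B-series. -/
theorem term_eq_pairing (f g : EuclideanSpace ℝ (Fin d) → EuclideanSpace ℝ (Fin d))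
    (C : Matrix (Fin d) (Fin d) ℝ) (A B M : Matrix (Fin s) (Fin s) ℝ) (h w : ℝ)
    (y : EuclideanSpace ℝ (Fin d)) (k k' : Fin 2) (p : Γ k × Γ k') :
    term f g C A B M h w y k k' p = ![h, w] k * ![h, w] k' *
      pairing C M (tterm ![f, g] ![h • A, w • B] y p.1.1)
        (tterm ![f, g] ![h • A, w • B] y p.2.1) := by
  simp only [term, pairing, tterm, bilin_smul_left, bilin_smul_right, Phi, dotProduct,
    Matrix.mulVec, Pi.smul_apply, smul_eq_mul, Finset.mul_sum, Finset.sum_mul]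
  exact Finset.sum_congr rfl fun i _ => Finset.sum_congr rfl fun j _ => by ring

theorem stageEq_iff {f g : EuclideanSpace ℝ (Fin d) → EuclideanSpace ℝ (Fin d)}
    {A B : Matrix (Fin s) (Fin s) ℝ} {h w : ℝ} {y : EuclideanSpace ℝ (Fin d)}
    {Y : Fin s → EuclideanSpace ℝ (Fin d)} :
    StageEq f g A B h w y Y ↔ ∀ i, Y i = y + ∑ k, ∑ j,
      (![h • A, w • B] : Fin 2 → Matrix (Fin s) (Fin s) ℝ) k i j • ![f, g] k (Y j) := by
  refine forall_congr' fun i => ?_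
  simp only [Fin.sum_univ_two, Matrix.cons_val_zero, Matrix.cons_val_one, Matrix.smul_apply,
    smul_eq_mul, Finset.smul_sum, smul_smul, add_assoc]

theorem sum_abs_row_le (A B : Matrix (Fin s) (Fin s) ℝ) {h w ε : ℝ} (hh : |h| ≤ ε)
    (hw : |w| ≤ ε) (k : Fin 2) (i : Fin s) :
    ∑ j, |(![h • A, w • B] : Fin 2 → Matrix (Fin s) (Fin s) ℝ) k i j| ≤
      (1 + ∑ i, ∑ j, |A i j| + ∑ i, ∑ j, |B i j|) * ε := by
  have hε : 0 ≤ ε := (abs_nonneg h).trans hh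
  have hrow : ∀ D : Matrix (Fin s) (Fin s) ℝ, ∑ j, |D i j| ≤ ∑ i, ∑ j, |D i j| := fun D =>
    Finset.single_le_sum (f := fun i => ∑ j, |D i j|)
      (fun i _ => Finset.sum_nonneg fun j _ => abs_nonneg _) (Finset.mem_univ i)
  have hsm : ∀ (D : Matrix (Fin s) (Fin s) ℝ) (c : ℝ), |c| ≤ ε →
      ∑ j, |(c • D) i j| ≤ (∑ i, ∑ j, |D i j|) * ε := fun D c hc => by
    simp only [Matrix.smul_apply, smul_eq_mul, abs_mul, ← Finset.mul_sum]
    rw [mul_comm]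
    exact mul_le_mul (hrow D) hc (abs_nonneg _)
      (Finset.sum_nonneg fun i _ => Finset.sum_nonneg fun j _ => abs_nonneg _)
  have hA : 0 ≤ (∑ i, ∑ j, |A i j|) * ε := by positivity
  have hB : 0 ≤ (∑ i, ∑ j, |B i j|) * ε := by positivity
  fin_cases k
  · exact (hsm A h hh).trans (by linarith)
  · exact (hsm B w hw).trans (by linarith)

theorem mem_pairs {k k' : Fin 2} {N : ℕ} {p : Γ k × Γ k'} :
    p ∈ pairs k k' N ↔ p.1.1.order + p.2.1.order ≤ N := by
  simp [pairs]

theorem order_tree_pos (ι : Tree) : 0 < ι.order := by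
  obtain ⟨t, rfl⟩ := Quotient.exists_rep ι
  exact t.order_pos

/-- Expansion to order `N` of one of the three contributions to the defect. -/
theorem exists_defect_bound {g : Fin 2 → EuclideanSpace ℝ (Fin d) → EuclideanSpace ℝ (Fin d)}
    (hg : ∀ k, ContDiff ℝ ∞ (g k)) (C : Matrix (Fin d) (Fin d) ℝ)
    (M : Matrix (Fin s) (Fin s) ℝ) (R r : ℝ) {b : ℝ} (hb : 0 ≤ b) (k k' : Fin 2) (N : ℕ) :
    ∃ K : ℝ, 0 ≤ K ∧ ∀ (y : EuclideanSpace ℝ (Fin d)) (ε z z' : ℝ)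
      (Z : Fin 2 → Matrix (Fin s) (Fin s) ℝ) (Y : Fin s → EuclideanSpace ℝ (Fin d)),
      ‖y‖ ≤ R → ε ≤ 1 → |z| ≤ ε → |z'| ≤ ε → (∀ k i, ∑ j, |Z k i j| ≤ b * ε) →
      (∀ i, ‖Y i - y‖ ≤ r) → (∀ i, Y i = y + ∑ k, ∑ j, Z k i j • g k (Y j)) →
        |z * z' * pairing C M (fun i => g k (Y i)) (fun i => g k' (Y i)) -
          ∑ p ∈ pairs k k' N, z * z' * pairing C M (tterm g Z y p.1.1) (tterm g Z y p.2.1)| ≤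
            K * ε ^ (N + 1) := by
  obtain ⟨G, hG0, hG⟩ := exists_bound hg (R + r)
  obtain ⟨K, hK0, hK⟩ := exists_expansion_bound (s := s) hg R r hb N
  choose T hT0 hT using exists_bound_tterm (s := s) hg R
  let m := (∑ i, ∑ j, |M i j|) * (∑ i, ∑ j, |C i j|)
  have hm : 0 ≤ m := by positivity
  -- `K1` accounts for truncating the two factors one after the other, `K2` for the pairs in the
  -- product of truncations that have more than `N` nodes together.
  let K1 := m * (K * G) + m * ((G + K) * K)
  let K2 := ∑ p ∈ treesUpTo k N ×ˢ treesUpTo k' N,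
    m * (T p.1.1 * b ^ (p.1.1.order - 1) * (T p.2.1 * b ^ (p.2.1.order - 1)))
  have hK2 : ∀ p : Γ k × Γ k', 0 ≤
      m * (T p.1.1 * b ^ (p.1.1.order - 1) * (T p.2.1 * b ^ (p.2.1.order - 1))) := fun p => by
    have := hT0 p.1.1
    have := hT0 p.2.1
    positivity
  refine ⟨K1 + K2, add_nonneg (by positivity) (Finset.sum_nonneg fun p _ => hK2 p),
    fun y ε z z' Z Y hy hε1 hz hz' hZ hr hY => ?_⟩
  have hε : 0 ≤ ε := (abs_nonneg z).trans hz
  have hzz : |z * z'| ≤ ε * ε := by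
    rw [abs_mul]; exact mul_le_mul hz hz' (abs_nonneg _) hε
  -- One factor `ε` suffices against the truncation error `ε ^ N`; the excess pairs use the full `ε
  -- * ε`, one factor for each root.
  have hzz1 : |z * z'| ≤ ε := hzz.trans (mul_le_of_le_one_left hε hε1)
  let x : ∀ k, Fin s → EuclideanSpace ℝ (Fin d) := fun k i =>
    ∑ ι ∈ treesUpTo k N, tterm g Z y ι.1 i
  have hux : ∀ k i, ‖g k (Y i) - x k i‖ ≤ K * ε ^ N := fun k i => by
    simp only [x, sum_treesUpTo_tterm hg]
    exact hK y ε Z Y hy hε hε1 hZ hr hY k i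
  have hu : ∀ k i, ‖g k (Y i)‖ ≤ G := fun k i => by
    refine hG k _ ?_
    calc ‖Y i‖ = ‖y + (Y i - y)‖ := by congr 1; abel
      _ ≤ R + r := (norm_add_le _ _).trans (add_le_add hy (hr i))
  have hεN : ε ^ N ≤ 1 := pow_le_one₀ hε hε1
  have hx : ∀ k i, ‖x k i‖ ≤ G + K := fun k i => by
    calc ‖x k i‖ = ‖g k (Y i) - (g k (Y i) - x k i)‖ := by congr 1; abel
      _ ≤ G + K * ε ^ N := (norm_sub_le _ _).trans (add_le_add (hu k i) (hux k i))
      _ ≤ G + K := by linarith [mul_le_of_le_one_right hK0 hεN]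
  -- truncating both factors
  have e1 : |z * z' * pairing C M (fun i => g k (Y i)) (fun i => g k' (Y i)) -
      z * z' * pairing C M (x k) (x k')| ≤ K1 * ε ^ (N + 1) := by
    rw [← mul_sub, abs_mul, pairing_sub]
    have h1 := abs_pairing_le C M (u := (fun i => g k (Y i)) - x k) (v := fun i => g k' (Y i))
      (by positivity) (fun i => hux k i) (fun i => hu k' i)
    have h2 := abs_pairing_le C M (u := x k) (v := (fun i => g k' (Y i)) - x k')
      (by positivity) (fun i => hx k i) (fun i => hux k' i)
    calc _ ≤ ε * (m * (K * ε ^ N * G) + m * ((G + K) * (K * ε ^ N))) :=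
          mul_le_mul hzz1 ((abs_add_le _ _).trans (add_le_add h1 h2)) (abs_nonneg _) hε
      _ = K1 * ε ^ (N + 1) := by simp only [K1]; ring
  -- the pairs of trees with more than `N` nodes altogether
  have e2 : |z * z' * pairing C M (x k) (x k') -
      ∑ p ∈ pairs k k' N, z * z' * pairing C M (tterm g Z y p.1.1) (tterm g Z y p.2.1)| ≤
        K2 * ε ^ (N + 1) := by
    classical
    have hsub : pairs k k' N ⊆ treesUpTo k N ×ˢ treesUpTo k' N := fun p hp => by
      rw [mem_pairs] at hp
      rw [Finset.mem_product, mem_treesUpTo, mem_treesUpTo]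
      omega
    have hx2 : pairing C M (x k) (x k') = ∑ p ∈ treesUpTo k N ×ˢ treesUpTo k' N,
        pairing C M (tterm g Z y p.1.1) (tterm g Z y p.2.1) :=
      pairing_sum M (treesUpTo k N) (treesUpTo k' N) (fun ι => tterm g Z y ι.1)
        fun ι => tterm g Z y ι.1
    rw [hx2, Finset.mul_sum, ← Finset.sum_sdiff hsub, add_sub_cancel_right, Finset.sum_mul]
    refine (Finset.abs_sum_le_sum_abs _ _).trans ?_
    refine (Finset.sum_le_sum fun p hp => ?_).trans
      (Finset.sum_le_sum_of_subset_of_nonneg Finset.sdiff_subset fun p _ _ =>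
        mul_nonneg (hK2 p) (by positivity))
    rw [Finset.mem_sdiff, mem_pairs] at hp
    have hq : 0 ≤ b * ε := mul_nonneg hb hε
    have ht := abs_pairing_le C M (u := tterm g Z y p.1.1) (v := tterm g Z y p.2.1)
      (mul_nonneg (hT0 p.1.1) (by positivity)) (hT p.1.1 y Z _ hy hq hZ)
      (hT p.2.1 y Z _ hy hq hZ)
    -- Trees are nonempty, so `order - 1 + 1` is the order in spite of truncated subtraction.
    have ho1 := order_tree_pos p.1.1
    have ho2 := order_tree_pos p.2.1
    rw [abs_mul]
    calc _ ≤ ε * ε * (m * (T p.1.1 * (b * ε) ^ (p.1.1.order - 1) *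
          (T p.2.1 * (b * ε) ^ (p.2.1.order - 1)))) :=
          mul_le_mul hzz ht (abs_nonneg _) (by positivity)
      _ = m * (T p.1.1 * b ^ (p.1.1.order - 1) * (T p.2.1 * b ^ (p.2.1.order - 1))) *
          (ε ^ (p.1.1.order - 1 + 1) * ε ^ (p.2.1.order - 1 + 1)) := by
          rw [mul_pow, mul_pow, pow_succ, pow_succ]; ring
      _ ≤ _ := by
          refine mul_le_mul_of_nonneg_left ?_ (hK2 p)
          rw [← pow_add]
          exact pow_le_pow_of_le_one hε hε1 (by omega)
  calc _ ≤ _ := abs_sub_le _ (z * z' * pairing C M (x k) (x k')) _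
    _ ≤ K1 * ε ^ (N + 1) + K2 * ε ^ (N + 1) := add_le_add e1 e2
    _ = _ := by ring

end Expansion

end SRK

/-- `W` is the driving process of the equation, for instance a Brownian motion; the expansion is
pathwise, so no property of `W` is required. Its first form is the expansion to every order in
`h, ΔW_n` for smooth coefficients; the second is the convergence of the three double series to the
defect for analytic coefficients. -/
theorem mainTheorem1 {d s : ℕ}
    (f g : EuclideanSpace ℝ (Fin d) → EuclideanSpace ℝ (Fin d))
    (hf : ContDiff ℝ ∞ f) (hg : ContDiff ℝ ∞ g)
    (C : Matrix (Fin d) (Fin d) ℝ) (hC : SRK.IsQuadraticInvariant f g C)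
    (A B : Matrix (Fin s) (Fin s) ℝ) (α β : Fin s → ℝ) (R r : ℝ) (hr : 0 < r) :
    ∃ δ : ℝ, 0 < δ ∧ ∃ K : ℕ → ℝ,
      (∀ (h w : ℝ) (y : EuclideanSpace ℝ (Fin d)), 0 < h → h ≤ δ → |w| ≤ δ → ‖y‖ ≤ R →
        ∃! Y : Fin s → EuclideanSpace ℝ (Fin d),
          (∀ i, ‖Y i - y‖ ≤ r) ∧ SRK.StageEq f g A B h w y Y) ∧
      ∀ (Ω : Type*) (W : ℝ → Ω → ℝ) (y : ℕ → Ω → EuclideanSpace ℝ (Fin d))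
        (Y : ℕ → Fin s → Ω → EuclideanSpace ℝ (Fin d)) (h : ℝ) (NT : ℕ) (o : Ω),
        0 < h → h ≤ δ →
        SRK.IsSRKSolution f g A B α β h NT (fun t => W t o) (fun n => y n o)
          (fun n i => Y n i o) →
        ∀ n < NT, ∀ ΔW : ℝ, ΔW = SRK.incr (fun t => W t o) h n → |ΔW| ≤ δ →
          ‖y n o‖ ≤ R → (∀ i, ‖Y n i o - y n o‖ ≤ r) →
          (∀ N : ℕ,
            |(SRK.quad C (y (n + 1) o) - SRK.quad C (y n o)) -
              (- ∑ p ∈ SRK.pairs 0 0 N,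
                  SRK.term f g C A B (SRK.MDiag A α) h ΔW (y n o) 0 0 p
                - 2 * ∑ p ∈ SRK.pairs 0 1 N,
                  SRK.term f g C A B (SRK.MStar A B α β) h ΔW (y n o) 0 1 p
                - ∑ p ∈ SRK.pairs 1 1 N,
                  SRK.term f g C A B (SRK.MDiag B β) h ΔW (y n o) 1 1 p)|
              ≤ K N * (h + |ΔW|) ^ (N + 1)) ∧
          (AnalyticOnNhd ℝ f Set.univ → AnalyticOnNhd ℝ g Set.univ →
            Summable (SRK.term f g C A B (SRK.MDiag A α) h ΔW (y n o) 0 0) ∧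
            Summable (SRK.term f g C A B (SRK.MStar A B α β) h ΔW (y n o) 0 1) ∧
            Summable (SRK.term f g C A B (SRK.MDiag B β) h ΔW (y n o) 1 1) ∧
            SRK.quad C (y (n + 1) o) - SRK.quad C (y n o) =
              - ∑' p : SRK.Γ 0 × SRK.Γ 0,
                  SRK.term f g C A B (SRK.MDiag A α) h ΔW (y n o) 0 0 p
              - 2 * ∑' p : SRK.Γ 0 × SRK.Γ 1,
                  SRK.term f g C A B (SRK.MStar A B α β) h ΔW (y n o) 0 1 p
              - ∑' p : SRK.Γ 1 × SRK.Γ 1,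
                  SRK.term f g C A B (SRK.MDiag B β) h ΔW (y n o) 1 1 p) := by
  have hG : ∀ k, ContDiff ℝ ∞ ((![f, g] : Fin 2 → _) k) := fun k => by
    fin_cases k
    · exact hf
    · exact hg
  -- The summand 1 makes `b` positive even when both tableaux vanish.
  set b : ℝ := 1 + ∑ i, ∑ j, |A i j| + ∑ i, ∑ j, |B i j| with hb
  have hb0 : 0 < b := by positivity
  obtain ⟨q₀, hq₀, huniq⟩ := SRK.exists_unique_stages (s := s) hG R hr
  -- `δ` must be fixed before analyticity is assumed, so the bound is obtained by cases; without
  -- analyticity the value 1 is a dummy.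
  obtain ⟨q₁, hq₁, hseries⟩ : ∃ q : ℝ, 0 < q ∧
      (AnalyticOnNhd ℝ f Set.univ → AnalyticOnNhd ℝ g Set.univ →
        ∀ (y : EuclideanSpace ℝ (Fin d)) (Z : Fin 2 → Matrix (Fin s) (Fin s) ℝ)
        (Y : Fin s → EuclideanSpace ℝ (Fin d)), ‖y‖ ≤ R → (∀ k i, ∑ j, |Z k i j| ≤ q) →
        (∀ i, ‖Y i - y‖ ≤ r) → (∀ i, Y i = y + ∑ k, ∑ j, Z k i j • ![f, g] k (Y j)) →
        ∀ k i, HasSum (fun ι : SRK.Γ k => SRK.tterm ![f, g] Z y ι.1 i) (![f, g] k (Y i))) := by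
    by_cases han : AnalyticOnNhd ℝ f Set.univ ∧ AnalyticOnNhd ℝ g Set.univ
    · obtain ⟨q, hq, h⟩ := SRK.exists_hasSum_stages (s := s) hG (fun k => by
        fin_cases k
        · exact han.1
        · exact han.2) R hr
      exact ⟨q, hq, fun _ _ y Z Y hy hZ hYr hY k i =>
        SRK.hasSum_tterm hG (h y Z Y hy hZ hYr hY k i)⟩
    · exact ⟨1, one_pos, fun h1 h2 => (han ⟨h1, h2⟩).elim⟩
  choose K0 hK0 hK0' using SRK.exists_defect_bound hG C (SRK.MDiag A α) R r hb0.le 0 0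
  choose K1 hK1 hK1' using SRK.exists_defect_bound hG C (SRK.MStar A B α β) R r hb0.le 0 1
  choose K2 hK2 hK2' using SRK.exists_defect_bound hG C (SRK.MDiag B β) R r hb0.le 1 1
  -- The expansion parameter is `ε = h + |ΔW|`. The first entry gives `ε ≤ 1`, the second `b * ε ≤
  -- min q₀ q₁`; the 2 in the constants is the factor of the mixed sum.
  refine ⟨min (1 / 2) (min q₀ q₁ / (2 * b)), by positivity,
    fun N => K0 N + 2 * K1 N + K2 N, ?_, ?_⟩
  · intro h w y hh hhδ hwδ hy
    have hrow := SRK.sum_abs_row_le A B (h := h) (w := w) (ε := min q₀ q₁ / (2 * b))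
      (by rw [abs_of_pos hh]; exact hhδ.trans (min_le_right _ _)) (hwδ.trans (min_le_right _ _))
    simp only [SRK.stageEq_iff]
    refine huniq y _ hy fun k i => (hrow k i).trans ?_
    rw [← hb]
    have : b * (min q₀ q₁ / (2 * b)) = min q₀ q₁ / 2 := by field_simp
    rw [this]
    have := min_le_left q₀ q₁
    linarith
  · intro Ω W y Y h NT o hh hhδ hsol n hn w hw hwδ hy hYr
    obtain ⟨hst, hstep⟩ := hsol n hn
    rw [← hw] at hst hstep
    have hε : |h| ≤ h + |w| := by rw [abs_of_pos hh]; linarith [abs_nonneg w]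
    have hε' : |w| ≤ h + |w| := by linarith
    have hε1 : h + |w| ≤ 1 := by
      have := hhδ.trans (min_le_left _ _)
      have := hwδ.trans (min_le_left _ _)
      linarith
    have hrow := SRK.sum_abs_row_le A B hε hε'
    rw [← hb] at hrow
    have hY := SRK.stageEq_iff.1 hst
    have hdefect := SRK.quad_step_sub hC hst hstep
    refine ⟨fun N => ?_, fun hfa hga => ?_⟩
    · have h0 := hK0' N (y n o) (h + |w|) h h _ _ hy hε1 hε hε hrow hYr hY
      have h1 := hK1' N (y n o) (h + |w|) h w _ _ hy hε1 hε hε' hrow hYr hY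
      have h2 := hK2' N (y n o) (h + |w|) w w _ _ hy hε1 hε' hε' hrow hYr hY
      rw [hdefect]
      simp only [SRK.term_eq_pairing]
      simp only [Matrix.cons_val_zero, Matrix.cons_val_one] at h0 h1 h2 ⊢
      rw [abs_le] at h0 h1 h2 ⊢
      constructor <;> linarith [h0.1, h0.2, h1.1, h1.2, h2.1, h2.2]
    · have hsum := hseries hfa hga (y n o) _ _ hy (fun k i => (hrow k i).trans (by
        have h1 := hhδ.trans (min_le_right _ _)
        have h2 := hwδ.trans (min_le_right _ _)
        calc b * (h + |w|) ≤ b * (min q₀ q₁ / (2 * b) + min q₀ q₁ / (2 * b)) := by gcongr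
          _ = min q₀ q₁ := by field_simp; ring
          _ ≤ q₁ := min_le_right _ _)) hYr hY
      have h0 := (SRK.hasSum_pairing (C := C) (SRK.MDiag A α) (hsum 0) (hsum 0)).mul_left (h * h)
      have h1 := (SRK.hasSum_pairing (C := C) (SRK.MStar A B α β) (hsum 0) (hsum 1)).mul_left
        (h * w)
      have h2 := (SRK.hasSum_pairing (C := C) (SRK.MDiag B β) (hsum 1) (hsum 1)).mul_left (w * w)
      have e0 : SRK.term f g C A B (SRK.MDiag A α) h w (y n o) 0 0 = _ :=
        funext (SRK.term_eq_pairing f g C A B (SRK.MDiag A α) h w (y n o) 0 0)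
      have e1 : SRK.term f g C A B (SRK.MStar A B α β) h w (y n o) 0 1 = _ :=
        funext (SRK.term_eq_pairing f g C A B (SRK.MStar A B α β) h w (y n o) 0 1)
      have e2 : SRK.term f g C A B (SRK.MDiag B β) h w (y n o) 1 1 = _ :=
        funext (SRK.term_eq_pairing f g C A B (SRK.MDiag B β) h w (y n o) 1 1)
      rw [e0, e1, e2]
      refine ⟨h0.summable, h1.summable, h2.summable, ?_⟩
      rw [hdefect]
      have t0 := h0.tsum_eq
      have t1 := h1.tsum_eq
      have t2 := h2.tsum_eq
      simp only [Matrix.cons_val_zero, Matrix.cons_val_one] at t0 t1 t2 ⊢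
      rw [t0, t1, t2]
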